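/- Let $\Omega\subseteq\mathbb R^d$ be open, and let $H^1(\Omega)$ be the complex Sobolev space of all $f\in L^2(\Omega)$ with weak gradient $\nabla f\in L^2(\Omega;\mathbb C^d)$, equipped with the norm $\|f\|_1^2=\|\nabla f\|_{L^2(\Omega;\mathbb C^d)}^2+\|f\|_{L^2(\Omega)}^2$. An extension operator for $\Omega$ is a linear operator $E\colon H^1(\Omega)\to H^1(\mathbb R^d)$ such that $(Ef)|_\Omega=f$ for all $f\in H^1(\Omega)$ and $\|E\|_1:=\sup_{\|f\|_1=1}\|Ef\|_1<\infty$. If extension operators for $\Omega$ exist, put $$\mathcal E(\Omega):=\inf_E\|E\|_1,$$ where the infimum is taken over all extension operators $E$ for $\Omega$. For $\varphi\in(0,\pi)$ let $$\Omega_\varphi:=\{(x_1,x_2)\in\mathbb R^2\colon x_2>\cot(\varphi/2)\,|x_1|\}$$ be the wedge with angle $\varphi$. Then extension operators for $\Omega_{\pi-\theta}$ exist for every $\theta\in(0,\pi)$, and, as $\theta\to0+$, $$\sqrt2+\frac{\sqrt2}{32}\theta^2+o(\theta^2)\ \le\ \mathcal E(\Omega_{\pi-\theta})\ \le\ \sqrt2+\frac{\sqrt2}{4}\theta+o(\theta);$$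 that is, there are functions $r_1,r_2\colon\mathbb R\to\mathbb R$ with $r_1(\theta)=o(\theta^2)$ and $r_2(\theta)=o(\theta)$ as $\theta\to0+$ such that $\sqrt2+\frac{\sqrt2}{32}\theta^2+r_1(\theta)\le\mathcal E(\Omega_{\pi-\theta})\le\sqrt2+\frac{\sqrt2}{4}\theta+r_2(\theta)$ for all $\theta\in(0,\pi)$. -/

import Mathlib

open Filter Topology MeasureTheory Asymptotics
open scoped ENNReal ContDiff

noncomputable section

namespace SobolevExtension

/-- Test functions on an open set `Ω ⊆ ℝ^d`: smooth, with compact support contained in `Ω`. -/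
structure IsTestFunction {d : ℕ} (Ω : TopologicalSpace.Opens (EuclideanSpace ℝ (Fin d)))
    (φ : EuclideanSpace ℝ (Fin d) → ℝ) : Prop where
  contDiff : ContDiff ℝ ∞ φ
  hasCompactSupport : HasCompactSupport φ
  tsupport_subset : tsupport φ ⊆ (Ω : Set (EuclideanSpace ℝ (Fin d)))

/-- The complex Lebesgue space `L²(Ω)`. -/
abbrev L2 {d : ℕ} (Ω : TopologicalSpace.Opens (EuclideanSpace ℝ (Fin d))) : Type :=
  Lp ℂ 2 ((volume : Measure (EuclideanSpace ℝ (Fin d))).restrict Ω)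

/-- The space `L²(Ω; ℂ^d)` of square-integrable vector fields. -/
abbrev L2Vec {d : ℕ} (Ω : TopologicalSpace.Opens (EuclideanSpace ℝ (Fin d))) : Type :=
  Lp (EuclideanSpace ℂ (Fin d)) 2 ((volume : Measure (EuclideanSpace ℝ (Fin d))).restrict Ω)

/-- `g ∈ L²(Ω; ℂ^d)` is the weak gradient of `u ∈ L²(Ω)`:
`∫_Ω u ∂ᵢφ = - ∫_Ω gᵢ φ` for all test functions `φ` on `Ω` and all `i`. -/
def IsWeakGradient {d : ℕ} {Ω : TopologicalSpace.Opens (EuclideanSpace ℝ (Fin d))}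
    (u : L2 Ω) (g : L2Vec Ω) : Prop :=
  ∀ φ : EuclideanSpace ℝ (Fin d) → ℝ, IsTestFunction Ω φ → ∀ i : Fin d,
    ∫ x in Ω, (fderiv ℝ φ x (EuclideanSpace.single i 1)) • u x = - ∫ x in Ω, φ x • g x i

section Helpers

variable {d : ℕ} {Ω : TopologicalSpace.Opens (EuclideanSpace ℝ (Fin d))}

/-- A bounded continuous compactly supported function times an `L²` function is integrable. -/
theorem integrable_smul {ψ : EuclideanSpace ℝ (Fin d) → ℝ} (hψ : Continuous ψ)
    (hc : HasCompactSupport ψ) {v : EuclideanSpace ℝ (Fin d) → ℂ}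
    (hv : MemLp v 2 (volume.restrict (Ω : Set (EuclideanSpace ℝ (Fin d))))) :
    Integrable (fun x => ψ x • v x)
      (volume.restrict (Ω : Set (EuclideanSpace ℝ (Fin d)))) :=
  memLp_one_iff_integrable.1
    (hv.smul ((hψ.memLp_of_hasCompactSupport hc (p := 2)).restrict _) (r := 1))

theorem memLp_apply (g : L2Vec Ω) (i : Fin d) :
    MemLp (fun x => g x i) 2 (volume.restrict (Ω : Set (EuclideanSpace ℝ (Fin d)))) :=
  (EuclideanSpace.proj (𝕜 := ℂ) i : EuclideanSpace ℂ (Fin d) →L[ℂ] ℂ).comp_memLp' (Lp.memLp g)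

theorem IsTestFunction.continuous_deriv {φ : EuclideanSpace ℝ (Fin d) → ℝ}
    (h : IsTestFunction Ω φ) (i : Fin d) :
    Continuous (fun x => fderiv ℝ φ x (EuclideanSpace.single i 1)) :=
  (h.contDiff.continuous_fderiv (by simp)).clm_apply continuous_const

theorem IsWeakGradient.zero : IsWeakGradient (0 : L2 Ω) (0 : L2Vec Ω) := by
  intro φ _ i
  have h1 : ∫ x in Ω, (fderiv ℝ φ x (EuclideanSpace.single i 1)) • (0 : L2 Ω) x = 0 := by
    apply integral_eq_zero_of_ae
    filter_upwards [Lp.coeFn_zero ℂ 2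
      (volume.restrict (Ω : Set (EuclideanSpace ℝ (Fin d))))] with x hx
    rw [hx]
    simp
  have h2 : ∫ x in Ω, φ x • (0 : L2Vec Ω) x i = 0 := by
    apply integral_eq_zero_of_ae
    filter_upwards [Lp.coeFn_zero (EuclideanSpace ℂ (Fin d)) 2
      (volume.restrict (Ω : Set (EuclideanSpace ℝ (Fin d))))] with x hx
    rw [hx]
    simp
  rw [h1, h2, neg_zero]

theorem IsWeakGradient.add {u v : L2 Ω} {g h : L2Vec Ω}
    (hu : IsWeakGradient u g) (hv : IsWeakGradient v h) : IsWeakGradient (u + v) (g + h) := by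
  intro φ hφ i
  have h1 : ∫ x in Ω, (fderiv ℝ φ x (EuclideanSpace.single i 1)) • (u + v : L2 Ω) x =
      ∫ x in Ω, ((fderiv ℝ φ x (EuclideanSpace.single i 1)) • u x +
        (fderiv ℝ φ x (EuclideanSpace.single i 1)) • v x) := by
    apply integral_congr_ae
    filter_upwards [Lp.coeFn_add u v] with x hx
    rw [hx]
    simp
  have h2 : ∫ x in Ω, φ x • (g + h : L2Vec Ω) x i =
      ∫ x in Ω, (φ x • g x i + φ x • h x i) := by
    apply integral_congr_ae
    filter_upwards [Lp.coeFn_add g h] with x hx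
    rw [hx]
    simp
  have hd := hφ.continuous_deriv i
  have hdc : HasCompactSupport (fun x => fderiv ℝ φ x (EuclideanSpace.single i 1)) :=
    hφ.hasCompactSupport.fderiv_apply (𝕜 := ℝ) _
  rw [h1, h2, integral_add (integrable_smul hd hdc (Lp.memLp u))
      (integrable_smul hd hdc (Lp.memLp v)),
    integral_add (integrable_smul hφ.contDiff.continuous hφ.hasCompactSupport (memLp_apply g i))
      (integrable_smul hφ.contDiff.continuous hφ.hasCompactSupport (memLp_apply h i)),
    hu φ hφ i, hv φ hφ i, neg_add]

theorem IsWeakGradient.smul {u : L2 Ω} {g : L2Vec Ω} (c : ℂ)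
    (hu : IsWeakGradient u g) : IsWeakGradient (c • u) (c • g) := by
  intro φ hφ i
  have h1 : ∫ x in Ω, (fderiv ℝ φ x (EuclideanSpace.single i 1)) • (c • u : L2 Ω) x =
      ∫ x in Ω, c • ((fderiv ℝ φ x (EuclideanSpace.single i 1)) • u x) := by
    apply integral_congr_ae
    filter_upwards [Lp.coeFn_smul c u] with x hx
    rw [hx]
    simp [mul_left_comm]
  have h2 : ∫ x in Ω, φ x • (c • g : L2Vec Ω) x i = ∫ x in Ω, c • (φ x • g x i) := by
    apply integral_congr_ae
    filter_upwards [Lp.coeFn_smul c g] with x hx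
    rw [hx]
    simp [mul_left_comm]
  rw [h1, h2, integral_smul, integral_smul, hu φ hφ i, smul_neg]

/-- The weak gradient is unique. -/
theorem IsWeakGradient.unique {u : L2 Ω} {g h : L2Vec Ω}
    (hg : IsWeakGradient u g) (hh : IsWeakGradient u h) : g = h := by
  have key : ∀ i : Fin d,
      ∀ᵐ x ∂(volume.restrict (Ω : Set (EuclideanSpace ℝ (Fin d)))), g x i - h x i = 0 := by
    intro i
    rw [ae_restrict_iff' Ω.isOpen.measurableSet]
    have hL : LocallyIntegrableOn (fun x => g x i - h x i)
        (Ω : Set (EuclideanSpace ℝ (Fin d))) volume :=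
      locallyIntegrableOn_of_locallyIntegrable_restrict
        (((memLp_apply g i).sub (memLp_apply h i)).locallyIntegrable (by norm_num))
    apply Ω.isOpen.ae_eq_zero_of_integral_contDiff_smul_eq_zero hL
    intro φ h1 h2 h3
    have hφ : IsTestFunction Ω φ := ⟨h1, h2, h3⟩
    have e : ∫ x in Ω, φ x • g x i = ∫ x in Ω, φ x • h x i :=
      neg_injective ((hg φ hφ i).symm.trans (hh φ hφ i))
    have hz : ∫ x in Ω, φ x • (g x i - h x i) = 0 := by
      simp only [smul_sub]
      rw [integral_sub (integrable_smul h1.continuous h2 (memLp_apply g i))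
        (integrable_smul h1.continuous h2 (memLp_apply h i)), e, sub_self]
    rw [← hz]
    symm
    apply setIntegral_eq_integral_of_forall_compl_eq_zero
    intro x hx
    rw [image_eq_zero_of_notMem_tsupport (fun hx' => hx (h3 hx')), zero_smul]
  apply Lp.ext
  filter_upwards [ae_all_iff.2 key] with x hx
  ext i
  exact sub_eq_zero.1 (hx i)

end Helpers

/-- The Sobolev space `H¹(Ω)`, realized as the space of pairs `(u, ∇u)` with `u ∈ L²(Ω)` and weak
gradient `∇u ∈ L²(Ω; ℂ^d)`; by `IsWeakGradient.unique` a pair is determined by `u`. The norm is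
the one inherited from the Hilbert space `L²(Ω) ⊕ L²(Ω; ℂ^d)`, that is
`‖u‖₁² = ‖u‖² + ‖∇u‖²` (see `H1.norm_sq`). -/
def H1 {d : ℕ} (Ω : TopologicalSpace.Opens (EuclideanSpace ℝ (Fin d))) :
    Submodule ℂ (WithLp 2 (L2 Ω × L2Vec Ω)) where
  carrier := {w | IsWeakGradient w.fst w.snd}
  add_mem' := fun hu hv => IsWeakGradient.add hu hv
  zero_mem' := IsWeakGradient.zero
  smul_mem' := fun c _ hu => IsWeakGradient.smul c hu

/-- The underlying function `u ∈ L²(Ω)` of an element of `H¹(Ω)`. -/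
def H1.fn {d : ℕ} {Ω : TopologicalSpace.Opens (EuclideanSpace ℝ (Fin d))} (f : H1 Ω) : L2 Ω :=
  (f : WithLp 2 (L2 Ω × L2Vec Ω)).fst

/-- The weak gradient `∇u ∈ L²(Ω; ℂ^d)` of an element of `H¹(Ω)`. -/
def H1.grad {d : ℕ} {Ω : TopologicalSpace.Opens (EuclideanSpace ℝ (Fin d))} (f : H1 Ω) :
    L2Vec Ω :=
  (f : WithLp 2 (L2 Ω × L2Vec Ω)).snd

theorem H1.norm_sq {d : ℕ} {Ω : TopologicalSpace.Opens (EuclideanSpace ℝ (Fin d))} (f : H1 Ω) :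
    ‖f‖ ^ 2 = ‖H1.grad f‖ ^ 2 + ‖H1.fn f‖ ^ 2 := by
  rw [add_comm]
  exact WithLp.prod_norm_sq_eq_of_L2 (f : WithLp 2 (L2 Ω × L2Vec Ω))

theorem H1.fn_injective {d : ℕ} {Ω : TopologicalSpace.Opens (EuclideanSpace ℝ (Fin d))} :
    Function.Injective (H1.fn : H1 Ω → L2 Ω) := by
  intro f f' h
  have hf : IsWeakGradient (H1.fn f) (H1.grad f) := f.2
  have hf' : IsWeakGradient (H1.fn f') (H1.grad f') := f'.2
  rw [← h] at hf'
  exact Subtype.ext (WithLp.ofLp_injective 2 (Prod.ext h (hf.unique hf')))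

/-- A bounded linear operator `E : H¹(Ω) → H¹(ℝ^d)` is an extension operator if
`(E f)|_Ω = f` for every `f ∈ H¹(Ω)`. -/
def IsExtensionOperator {d : ℕ} {Ω : TopologicalSpace.Opens (EuclideanSpace ℝ (Fin d))}
    (E : H1 Ω →L[ℂ] H1 (⊤ : TopologicalSpace.Opens (EuclideanSpace ℝ (Fin d)))) : Prop :=
  ∀ f : H1 Ω, (H1.fn (E f) : EuclideanSpace ℝ (Fin d) → ℂ)
    =ᵐ[volume.restrict (Ω : Set (EuclideanSpace ℝ (Fin d)))] H1.fn f

/-- The infimum of the operator norms of all extension operators for `Ω`.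
(The value would be `0` if there were none, whereas it is at least `1` if `H¹(Ω) ≠ 0`
and there are some.) -/
def minExtensionNorm {d : ℕ} (Ω : TopologicalSpace.Opens (EuclideanSpace ℝ (Fin d))) : ℝ :=
  sInf {c : ℝ | ∃ E : H1 Ω →L[ℂ] H1 (⊤ : TopologicalSpace.Opens (EuclideanSpace ℝ (Fin d))),
    IsExtensionOperator E ∧ c = ‖E‖}

/-- The wedge `{(x₁, x₂) ∈ ℝ² : x₂ > cot(φ/2) |x₁|}` with angle `φ`. -/
def wedge (φ : ℝ) : TopologicalSpace.Opens (EuclideanSpace ℝ (Fin 2)) where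
  carrier := {x | Real.cot (φ / 2) * |x 0| < x 1}
  is_open' := isOpen_lt (by fun_prop) (by fun_prop)

end SobolevExtension

end

open Filter Topology MeasureTheory Asymptotics
open scoped ENNReal ContDiff

noncomputable section

namespace SobolevExtension

/-! With `t = tan (θ/2)` the wedge of angle `π - θ` is the region above the graph of `t |x₀|`, and
the two bounds are independent.

Upper bound: compose `f` with the fold `foldMap t`, which reflects vertically the points below the
graph. The fold is two-to-one and preserves measure on each sheet. Below the graph the gradient
becomes `(∂₀f ± 2t ∂₁f, -∂₁f)`, so the extension has squared norm at most `(2 + 2t + 4t²) ‖f‖²`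
(`exists_extensionOperator`), and the square root of this factor is `√2 + (√2/4) θ + o(θ)`. The
chain rule for a merely weakly differentiable `f` is `integral_fderiv_smul_foldMap`.

Lower bound: let `G` be a truncated logarithm at the vertex, with energy of order `K`. Its energy is
radial, so the wedge carries at most the fraction `(π - θ)/(2π)` of it. Any extension of the
restriction of `G` is `G + w` with `w` vanishing on the wedge. Since `log |x|` is harmonic, `ΔG`
lives at only two scales, and a scale-invariant estimate gives `|⟨G, w⟩| ≤ C ‖w‖` with `C`
independent of `K` (`exists_log_testFunction`). Hence `‖G + w‖² ≥ ‖G‖² - C²`, and `K → ∞` yields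
`‖E‖² ≥ 2π/(π - θ)` (`two_pi_le_norm_sq_extension`). This grows linearly in `θ` and so exceeds the
required quadratic bound. -/

/-- The Euclidean plane. -/
abbrev Plane : Type := EuclideanSpace ℝ (Fin 2)

/-- The coordinates of the plane, as a measurable equivalence with `ℝ × ℝ`. -/
def planeEquiv : Plane ≃ᵐ ℝ × ℝ :=
  (MeasurableEquiv.toLp 2 (Fin 2 → ℝ)).symm.trans MeasurableEquiv.finTwoArrow

theorem planeEquiv_apply (x : Plane) : planeEquiv x = (x 0, x 1) := rfl

theorem planeEquiv_symm_apply (p : ℝ × ℝ) : planeEquiv.symm p = !₂[p.1, p.2] := by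
  apply planeEquiv.injective
  rw [MeasurableEquiv.apply_symm_apply, planeEquiv_apply]
  simp

theorem measurePreserving_planeEquiv : MeasurePreserving planeEquiv volume volume :=
  (volume_preserving_finTwoArrow ℝ).comp
    (EuclideanSpace.volume_preserving_symm_measurableEquiv_toLp (Fin 2))

/-! ### The wedge, its vertical reflection and the fold -/

/-- The region above the graph of `t |x₀|`. -/
def aboveCone (t : ℝ) : TopologicalSpace.Opens Plane where
  carrier := {x | t * |x 0| < x 1}
  is_open' := isOpen_lt (by fun_prop) (by fun_prop)

theorem mem_aboveCone {t : ℝ} {x : Plane} : x ∈ (aboveCone t : Set Plane) ↔ t * |x 0| < x 1 :=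
  Iff.rfl

theorem wedge_eq_aboveCone (φ : ℝ) : wedge φ = aboveCone (Real.cot (φ / 2)) := rfl

/-- The vertical reflection at the graph of `t |x₀|`. -/
def flipMap (t : ℝ) (x : Plane) : Plane := !₂[x 0, 2 * t * |x 0| - x 1]

/-- The retraction of the plane onto the closure of `aboveCone t` which reflects the points
below the graph. -/
def foldMap (t : ℝ) (x : Plane) : Plane := !₂[x 0, t * |x 0| + |x 1 - t * (|x 0|)|]

@[simp] theorem flipMap_zero (t : ℝ) (x : Plane) : flipMap t x 0 = x 0 := rfl
@[simp] theorem flipMap_one (t : ℝ) (x : Plane) : flipMap t x 1 = 2 * t * |x 0| - x 1 := rfl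
@[simp] theorem foldMap_zero (t : ℝ) (x : Plane) : foldMap t x 0 = x 0 := rfl
@[simp] theorem foldMap_one (t : ℝ) (x : Plane) :
    foldMap t x 1 = t * |x 0| + |x 1 - t * (|x 0|)| := rfl

theorem continuous_toLp_two {X : Type*} [TopologicalSpace X] {f g : X → ℝ} (hf : Continuous f)
    (hg : Continuous g) : Continuous (fun x => (!₂[f x, g x] : Plane)) := by
  refine (PiLp.continuous_toLp 2 (fun _ : Fin 2 => ℝ)).comp (continuous_pi fun i => ?_)
  fin_cases i
  · exact hf
  · exact hg

theorem continuous_foldMap (t : ℝ) : Continuous (foldMap t) :=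
  continuous_toLp_two (by fun_prop) (by fun_prop)

theorem foldMap_of_mem {t : ℝ} {x : Plane} (hx : x ∈ (aboveCone t : Set Plane)) :
    foldMap t x = x := by
  have hx' : t * |x 0| < x 1 := hx
  ext i
  fin_cases i
  · simp
  · simp [abs_of_pos (sub_pos.2 hx')]

theorem foldMap_of_notMem {t : ℝ} {x : Plane} (hx : x ∉ (aboveCone t : Set Plane)) :
    foldMap t x = flipMap t x := by
  have hx' : x 1 ≤ t * |x 0| := not_lt.1 hx
  ext i
  fin_cases i
  · simp
  · simp [abs_of_nonpos (sub_nonpos.2 hx')]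
    ring

/-- On each vertical line the map is a reflection of `ℝ`, so it is a skew product of
measure-preserving maps. -/
theorem measurePreserving_flipMap (t : ℝ) : MeasurePreserving (flipMap t) volume volume := by
  have h : MeasurePreserving (fun p : ℝ × ℝ => (p.1, 2 * t * |p.1| - p.2)) volume volume := by
    refine (MeasurePreserving.id (volume : Measure ℝ)).skew_product
      (g := fun a b => 2 * t * |a| - b) (by fun_prop) (ae_of_all _ fun a => ?_)
    exact (Measure.measurePreserving_sub_left (volume : Measure ℝ) (2 * t * |a|)).map_eq
  have h2 : flipMap t = planeEquiv.symm ∘ (fun p : ℝ × ℝ => (p.1, 2 * t * |p.1| - p.2)) ∘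
      planeEquiv := by
    funext x
    simp only [Function.comp, planeEquiv_symm_apply, planeEquiv_apply]
    rfl
  rw [h2]
  exact (measurePreserving_planeEquiv.symm).comp (h.comp measurePreserving_planeEquiv)

theorem ae_snd_ne {c : ℝ → ℝ} (hc : Measurable c) : ∀ᵐ x : Plane, x 1 ≠ c (x 0) := by
  have h : ∀ᵐ p : ℝ × ℝ, p.2 ≠ c p.1 := by
    rw [ae_iff, Measure.volume_eq_prod, Measure.measure_prod_null]
    · refine ae_of_all _ fun a => ?_
      have : Prod.mk a ⁻¹' {p : ℝ × ℝ | ¬ p.2 ≠ c p.1} = {c a} := by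
        ext b; simp
      change volume (Prod.mk a ⁻¹' {p : ℝ × ℝ | ¬ p.2 ≠ c p.1}) = 0
      rw [this]
      simp
    · simp only [not_not]
      exact measurableSet_eq_fun measurable_snd (hc.comp measurable_fst)
  exact measurePreserving_planeEquiv.quasiMeasurePreserving.ae h

theorem ae_fst_ne_zero : ∀ᵐ x : Plane, x 0 ≠ 0 := by
  have h : ∀ᵐ p : ℝ × ℝ, p.1 ≠ 0 := by
    refine Measure.quasiMeasurePreserving_fst.ae (p := fun a : ℝ => a ≠ 0) ?_
    simp [ae_iff]
  exact measurePreserving_planeEquiv.quasiMeasurePreserving.ae h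

theorem setLIntegral_foldMap (t : ℝ) (q : Plane → ℝ≥0∞) :
    ∫⁻ x in (aboveCone t : Set Plane), q (foldMap t x) = ∫⁻ x in (aboveCone t : Set Plane), q x :=
  setLIntegral_congr_fun (aboveCone t).isOpen.measurableSet
    fun x hx => by rw [foldMap_of_mem hx]

theorem setLIntegral_compl_foldMap (t : ℝ) {q : Plane → ℝ≥0∞} (hq : Measurable q) :
    ∫⁻ x in (aboveCone t : Set Plane)ᶜ, q (foldMap t x) =
      ∫⁻ x in (aboveCone t : Set Plane), q x := by
  rw [← (measurePreserving_flipMap t).setLIntegral_comp_preimage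
    (aboveCone t).isOpen.measurableSet hq]
  have h1 : ((aboveCone t : Set Plane)ᶜ : Set Plane) =ᵐ[volume]
      flipMap t ⁻¹' (aboveCone t : Set Plane) := by
    filter_upwards [ae_snd_ne (c := fun a => t * |a|) (by fun_prop)] with x hx
    apply propext
    change ¬ (t * |x 0| < x 1) ↔ t * |x 0| < 2 * t * |x 0| - x 1
    constructor
    · intro h
      have := lt_of_le_of_ne (not_lt.1 h) hx
      linarith
    · intro h
      linarith
  rw [← setLIntegral_congr h1]
  exact setLIntegral_congr_fun (aboveCone t).isOpen.measurableSet.compl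
    fun x hx => by rw [foldMap_of_notMem hx]

theorem lintegral_foldMap (t : ℝ) {q : Plane → ℝ≥0∞} (hq : Measurable q) :
    ∫⁻ x, q (foldMap t x) = 2 * ∫⁻ x in (aboveCone t : Set Plane), q x := by
  rw [← lintegral_add_compl _ (aboveCone t).isOpen.measurableSet, setLIntegral_foldMap,
    setLIntegral_compl_foldMap t hq, two_mul]

/-- Both sheets of the fold preserve measure. This identity transports null sets, `L^p` membership
and norms from the wedge to the plane. -/
theorem map_foldMap (t : ℝ) : (volume : Measure Plane).map (foldMap t) =
    (2 : ℝ≥0∞) • volume.restrict (aboveCone t : Set Plane) := by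
  refine Measure.ext_of_lintegral _ fun q hq => ?_
  rw [lintegral_map hq (continuous_foldMap t).measurable, lintegral_foldMap t hq,
    lintegral_smul_measure, smul_eq_mul]

theorem ae_foldMap {t : ℝ} {p : Plane → Prop}
    (h : ∀ᵐ x ∂(volume.restrict (aboveCone t : Set Plane)), p x) :
    ∀ᵐ x : Plane, p (foldMap t x) := by
  refine ae_of_ae_map (continuous_foldMap t).aemeasurable ?_
  rw [map_foldMap]
  exact Measure.ae_smul_measure h _

theorem memLp_comp_foldMap {t : ℝ} {F : Type*} [NormedAddCommGroup F] {u : Plane → F} {p : ℝ≥0∞}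
    (hu : MemLp u p (volume.restrict (aboveCone t : Set Plane))) :
    MemLp (fun x => u (foldMap t x)) p volume := by
  refine MemLp.comp_of_map ?_ (continuous_foldMap t).aemeasurable
  rw [map_foldMap]
  exact hu.smul_measure (by norm_num)

/-! ### Norms, inner products and construction of elements of `H¹` -/

section General

variable {d : ℕ} {Ω : TopologicalSpace.Opens (EuclideanSpace ℝ (Fin d))}

theorem enorm_sq_lp_two {α F : Type*} [MeasurableSpace α] {μ : Measure α} [NormedAddCommGroup F]
    (v : Lp F 2 μ) : ‖v‖ₑ ^ 2 = ∫⁻ x, ‖v x‖ₑ ^ 2 ∂μ := by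
  have h := eLpNorm_nnreal_pow_eq_lintegral (f := v) (μ := μ) (p := 2) (by norm_num)
  rw [Lp.enorm_def]
  simpa using h

theorem enorm_sq_euclidean {n : ℕ} (y : EuclideanSpace ℂ (Fin n)) :
    ‖y‖ₑ ^ 2 = ∑ i, ‖y i‖ₑ ^ 2 := by
  have h := EuclideanSpace.norm_sq_eq y
  have h2 : ∀ {F : Type} [NormedAddCommGroup F] (z : F), ‖z‖ₑ ^ 2 = ENNReal.ofReal (‖z‖ ^ 2) := by
    intro F _ z
    rw [ENNReal.ofReal_pow (norm_nonneg _), ofReal_norm]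
  rw [h2, h, ENNReal.ofReal_sum_of_nonneg fun i _ => sq_nonneg _]
  exact Finset.sum_congr rfl fun i _ => (h2 _).symm

theorem H1.enorm_sq (f : H1 Ω) : ‖f‖ₑ ^ 2 =
    ∫⁻ x in (Ω : Set (EuclideanSpace ℝ (Fin d))),
      (‖H1.fn f x‖ₑ ^ 2 + ∑ i, ‖H1.grad f x i‖ₑ ^ 2) := by
  have h1 : ‖f‖ₑ ^ 2 = ‖H1.fn f‖ₑ ^ 2 + ‖H1.grad f‖ₑ ^ 2 := by
    simp only [← ofReal_norm]
    rw [← ENNReal.ofReal_pow (norm_nonneg _), H1.norm_sq, add_comm,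
      ENNReal.ofReal_add (sq_nonneg _) (sq_nonneg _), ENNReal.ofReal_pow (norm_nonneg _),
      ENNReal.ofReal_pow (norm_nonneg _)]
  rw [h1, enorm_sq_lp_two, enorm_sq_lp_two, lintegral_add_left']
  · simp only [enorm_sq_euclidean]
  · exact ((Lp.stronglyMeasurable _).aestronglyMeasurable.enorm.pow_const 2)

/-- Functions in `L²` satisfying the integration by parts formula define an element of `H¹`. -/
theorem H1.exists_of_integral_eq {u : EuclideanSpace ℝ (Fin d) → ℂ}
    {g : Fin d → EuclideanSpace ℝ (Fin d) → ℂ}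
    (hu : MemLp u 2 (volume.restrict (Ω : Set (EuclideanSpace ℝ (Fin d)))))
    (hg : ∀ i, MemLp (g i) 2 (volume.restrict (Ω : Set (EuclideanSpace ℝ (Fin d)))))
    (h : ∀ φ : EuclideanSpace ℝ (Fin d) → ℝ, IsTestFunction Ω φ → ∀ i : Fin d,
      ∫ x in Ω, (fderiv ℝ φ x (EuclideanSpace.single i 1)) • u x = - ∫ x in Ω, φ x • g i x) :
    ∃ f : H1 Ω, H1.fn f =ᵐ[volume.restrict (Ω : Set (EuclideanSpace ℝ (Fin d)))] u ∧
      ∀ i, (fun x => H1.grad f x i)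
        =ᵐ[volume.restrict (Ω : Set (EuclideanSpace ℝ (Fin d)))] g i := by
  have hG : MemLp (fun x => (WithLp.toLp 2 (fun i => g i x) : EuclideanSpace ℂ (Fin d))) 2
      (volume.restrict (Ω : Set (EuclideanSpace ℝ (Fin d)))) :=
    MemLp.of_eval_piLp hg
  have hw : IsWeakGradient hu.toLp hG.toLp := by
    intro φ hφ i
    have e1 : ∫ x in Ω, (fderiv ℝ φ x (EuclideanSpace.single i 1)) • (hu.toLp u) x =
        ∫ x in Ω, (fderiv ℝ φ x (EuclideanSpace.single i 1)) • u x := by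
      apply integral_congr_ae
      filter_upwards [hu.coeFn_toLp] with x hx
      rw [hx]
    have e2 : ∫ x in Ω, φ x • (hG.toLp _ : L2Vec Ω) x i = ∫ x in Ω, φ x • g i x := by
      apply integral_congr_ae
      filter_upwards [hG.coeFn_toLp] with x hx
      rw [hx]
    rw [e1, e2, h φ hφ i]
  refine ⟨⟨WithLp.toLp 2 (hu.toLp, hG.toLp), hw⟩, hu.coeFn_toLp, fun i => ?_⟩
  have := hG.coeFn_toLp
  filter_upwards [this] with x hx
  change (hG.toLp _ : L2Vec Ω) x i = g i x
  rw [hx]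

theorem H1.inner_eq (f g : H1 Ω) : inner ℂ f g =
    (∫ x in Ω, inner ℂ (H1.fn f x) (H1.fn g x)) +
      ∑ i, ∫ x in Ω, inner ℂ (H1.grad f x i) (H1.grad g x i) := by
  have h : inner ℂ f g = inner ℂ (H1.fn f) (H1.fn g) + inner ℂ (H1.grad f) (H1.grad g) :=
    WithLp.prod_inner_apply _ _
  rw [h, L2.inner_def, L2.inner_def, ← integral_finsetSum]
  · simp only [PiLp.inner_apply]
  · intro i _
    refine (L2.integrable_inner (𝕜 := ℂ) ((memLp_apply (H1.grad f) i).toLp _)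
      ((memLp_apply (H1.grad g) i).toLp _)).congr ?_
    filter_upwards [(memLp_apply (H1.grad f) i).coeFn_toLp,
      (memLp_apply (H1.grad g) i).coeFn_toLp] with x h1 h2
    rw [h1, h2]

end General

/-! ### Derivatives of smooth functions composed with the fold -/

/-- The matrix `∂ᵢ (foldMap t)ⱼ`, away from the graph of `t |x₀|` and the line `x₀ = 0`. -/
def foldJac (t : ℝ) (x : Plane) (i j : Fin 2) : ℝ :=
  !![1, t * SignType.sign (x 0) * (1 - SignType.sign (x 1 - t * |x 0|));
    0, (SignType.sign (x 1 - t * |x 0|) : ℝ)] i j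

theorem hasDerivAt_foldMap {t : ℝ} {x : Plane} (h0 : x 0 ≠ 0) (h1 : x 1 ≠ t * |x 0|) (i : Fin 2) :
    HasDerivAt (fun s : ℝ => foldMap t (x + s • EuclideanSpace.single i 1))
      (WithLp.toLp 2 (foldJac t x i)) 0 := by
  have hc : ∀ k : Fin 2, HasDerivAt (fun s : ℝ => (x + s • EuclideanSpace.single i (1 : ℝ)) k)
      ((EuclideanSpace.single i (1 : ℝ) : Plane) k) 0 := by
    intro k
    have := ((hasDerivAt_id (0 : ℝ)).mul_const
      ((EuclideanSpace.single i (1 : ℝ) : Plane) k)).const_add (x k)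
    simpa using this
  have ha : HasDerivAt (fun s : ℝ => |(x + s • EuclideanSpace.single i (1 : ℝ)) 0|)
      (SignType.sign (x 0) * (EuclideanSpace.single i (1 : ℝ) : Plane) 0) 0 := by
    have := (hasDerivAt_abs (x := (x + (0 : ℝ) • EuclideanSpace.single i (1 : ℝ)) 0)
      (by simpa using h0)).comp (0 : ℝ) (hc 0)
    simpa [Function.comp_def] using this
  have hb := (hasDerivAt_abs (x := (x + (0 : ℝ) • EuclideanSpace.single i (1 : ℝ)) 1 -
    t * |(x + (0 : ℝ) • EuclideanSpace.single i (1 : ℝ)) 0|)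
    (by simpa [sub_eq_zero] using h1)).comp (0 : ℝ) ((hc 1).sub (ha.const_mul t))
  have hd := (ha.const_mul t).add hb
  suffices h : HasDerivAt (fun s : ℝ => WithLp.ofLp (foldMap t (x + s • EuclideanSpace.single i 1)))
      (foldJac t x i) 0 from
    (PiLp.hasFDerivAt_toLp (𝕜 := ℝ) (E := fun _ : Fin 2 => ℝ) 2 _).comp_hasDerivAt (0 : ℝ) h
  rw [hasDerivAt_pi]
  intro k
  fin_cases k
  · refine (hc 0).congr_deriv ?_
    fin_cases i <;> simp [foldJac]
  · refine hd.congr_deriv ?_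
    fin_cases i <;> simp [foldJac]
    ring

theorem ae_lineDeriv_comp_foldMap (t : ℝ) {ψ : Plane → ℝ} (hψ : Differentiable ℝ ψ) (i : Fin 2) :
    ∀ᵐ x : Plane, lineDeriv ℝ (fun x => ψ (foldMap t x)) x (EuclideanSpace.single i 1) =
      ∑ j, foldJac t x i j * fderiv ℝ ψ (foldMap t x) (EuclideanSpace.single j 1) := by
  filter_upwards [ae_fst_ne_zero, ae_snd_ne (c := fun a => t * |a|) (by fun_prop)] with x h0 h1
  have h := hasDerivAt_foldMap h0 h1 i
  have h2 : HasFDerivAt ψ (fderiv ℝ ψ (foldMap t x))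
      (foldMap t (x + (0 : ℝ) • EuclideanSpace.single i 1)) := by
    rw [zero_smul, add_zero]
    exact (hψ _).hasFDerivAt
  have h3 := h2.comp_hasDerivAt (0 : ℝ) h
  rw [lineDeriv]
  refine h3.deriv.trans ?_
  have h4 : (WithLp.toLp 2 (foldJac t x i) : Plane) =
      ∑ j, foldJac t x i j • EuclideanSpace.single j (1 : ℝ) := by
    ext k
    fin_cases k <;> simp
  rw [h4, map_sum]
  simp

theorem lipschitzWith_foldMap (t : ℝ) : ∃ C, LipschitzWith C (foldMap t) := by
  have hp : ∀ i : Fin 2, LipschitzWith 1 (fun x : Plane => x i) := fun i =>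
    LipschitzWith.of_dist_le_mul fun x y => by
      rw [NNReal.coe_one, one_mul, dist_eq_norm, dist_eq_norm]
      exact PiLp.norm_apply_le (x - y) i
  have habs : LipschitzWith 1 (fun a : ℝ => |a|) := lipschitzWith_one_norm
  have h1 : LipschitzWith (‖t‖₊ * (1 * 1)) (fun x : Plane => t * |x 0|) :=
    (lipschitzWith_smul t).comp (habs.comp (hp 0))
  have h2 := h1.add (habs.comp ((hp 1).sub h1))
  have e0 : ∀ i : Fin 2, LipschitzWith 1 (fun a : ℝ => (EuclideanSpace.single i a : Plane)) :=
    fun i => LipschitzWith.of_dist_le_mul fun a b => by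
      rw [NNReal.coe_one, one_mul, PiLp.dist_single_same]
  have h3 := ((e0 0).comp (hp 0)).add ((e0 1).comp h2)
  have e : foldMap t = fun x : Plane => EuclideanSpace.single 0 (x 0) +
      EuclideanSpace.single 1 (t * |x 0| + |x 1 - t * (|x 0|)|) := by
    funext x
    ext k
    fin_cases k <;> simp
  rw [e]
  exact ⟨_, h3⟩

/-- The composition `ψ ∘ foldMap t` is Lipschitz, so integration by parts is available for it, and
its line derivatives are given almost everywhere by the classical chain rule. -/
theorem integral_fderiv_mul_comp_foldMap (t : ℝ) {φ ψ : Plane → ℝ}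
    (hφ : ContDiff ℝ ∞ φ) (hφc : HasCompactSupport φ) (hψ : ContDiff ℝ ∞ ψ)
    (hψc : HasCompactSupport ψ) (i : Fin 2) :
    ∫ x, fderiv ℝ φ x (EuclideanSpace.single i 1) * ψ (foldMap t x) =
      - ∫ x, φ x * ∑ j, foldJac t x i j *
        fderiv ℝ ψ (foldMap t x) (EuclideanSpace.single j 1) := by
  obtain ⟨C, hC⟩ := lipschitzWith_foldMap t
  obtain ⟨D, hD⟩ := ContDiff.lipschitzWith_of_hasCompactSupport hφc hφ (by simp)
  obtain ⟨D', hD'⟩ := ContDiff.lipschitzWith_of_hasCompactSupport hψc hψ (by simp)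
  have h := LipschitzWith.integral_lineDeriv_mul_eq (μ := volume) (hD'.comp hC) hD hφc
    (EuclideanSpace.single i (1 : ℝ) : Plane)
  have h1 : ∫ x, φ x * ∑ j, foldJac t x i j *
      fderiv ℝ ψ (foldMap t x) (EuclideanSpace.single j 1) =
      ∫ x, lineDeriv ℝ (ψ ∘ foldMap t) x (EuclideanSpace.single i 1) * φ x := by
    apply integral_congr_ae
    filter_upwards [ae_lineDeriv_comp_foldMap t (hψ.differentiable (by simp)) i] with x hx
    rw [mul_comm, ← hx]
    rfl
  rw [h1, h, ← integral_neg]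
  congr 1
  funext x
  rw [(hφ.differentiable (by simp) x).lineDeriv_eq_fderiv]
  simp

/-! ### The weak chain rule for the fold -/

theorem tendsto_eLpNorm_translate {n : ℕ} {b : EuclideanSpace ℝ (Fin n) → ℂ}
    (hb : MemLp b 2 volume) (z₀ : EuclideanSpace ℝ (Fin n)) :
    Tendsto (fun z => eLpNorm (fun x => b (x + z) - b (x + z₀)) 2 volume) (𝓝 z₀) (𝓝 0) := by
  have : Fact ((2 : ℝ≥0∞) ≠ ⊤) := ⟨by norm_num⟩
  have hc : Continuous fun z : EuclideanSpace ℝ (Fin n) => DomAddAct.mk z +ᵥ hb.toLp b :=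
    continuous_vadd.comp ((DomAddAct.mkHomeomorph.continuous).prodMk continuous_const)
  have h := (tendsto_iff_edist_tendsto_0.1 (hc.tendsto z₀))
  refine h.congr fun z => ?_
  rw [Lp.edist_def]
  refine eLpNorm_congr_ae ?_
  have h1 : ∀ z : EuclideanSpace ℝ (Fin n),
      (DomAddAct.mk z +ᵥ hb.toLp b : Lp ℂ 2 (volume : Measure (EuclideanSpace ℝ (Fin n))))
        =ᵐ[volume] fun x => b (x + z) := by
    intro z
    rw [DomAddAct.mk_vadd_toLp]
    refine (MemLp.coeFn_toLp _).trans (ae_of_all _ fun x => ?_)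
    change b (z + x) = b (x + z)
    rw [add_comm]
  filter_upwards [h1 z, h1 z₀] with x hx hx0
  rw [← hx, ← hx0]
  rfl

/-- By Cauchy–Schwarz and `map_foldMap` this reduces, up to a factor `√2`, to continuity of
translations in `L²`. The function `b` lives on the whole plane because `foldMap t x + z` may leave
the wedge. -/
theorem continuous_integral_smul_foldMap_add (t : ℝ) {a : Plane → ℝ} {b : Plane → ℂ}
    (ha : MemLp a 2 volume) (hb : MemLp b 2 volume) :
    Continuous fun z : Plane => ∫ x, a x • b (foldMap t x + z) := by
  have hbz : ∀ z : Plane, MemLp (fun x => b (x + z)) 2 volume := fun z =>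
    hb.comp_measurePreserving (measurePreserving_add_right volume z)
  have hbf : ∀ z : Plane, MemLp (fun x => b (foldMap t x + z)) 2 volume := fun z =>
    memLp_comp_foldMap (u := fun y => b (y + z)) ((hbz z).restrict _)
  have hint : ∀ z : Plane, Integrable (fun x => a x • b (foldMap t x + z)) := fun z =>
    memLp_one_iff_integrable.1 ((hbf z).smul ha (r := 1))
  rw [continuous_iff_continuousAt]
  intro z₀
  rw [ContinuousAt, tendsto_iff_edist_tendsto_0]
  have hlim : Tendsto (fun z => eLpNorm a 2 volume *
      ((2 : ℝ≥0∞) ^ (1 / (2 : ℝ≥0∞)).toReal * eLpNorm (fun x => b (x + z) - b (x + z₀)) 2 volume))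
      (𝓝 z₀) (𝓝 0) := by
    have h2 := ENNReal.Tendsto.const_mul (a := (2 : ℝ≥0∞) ^ (1 / (2 : ℝ≥0∞)).toReal)
      (tendsto_eLpNorm_translate hb z₀) (Or.inr (by simp))
    have h3 := ENNReal.Tendsto.const_mul (a := eLpNorm a 2 volume) h2 (Or.inr ha.2.ne)
    simpa using h3
  refine tendsto_of_tendsto_of_tendsto_of_le_of_le tendsto_const_nhds hlim
    (fun _ => bot_le) fun z => ?_
  rw [edist_eq_enorm_sub, ← integral_sub (hint z) (hint z₀)]
  refine (enorm_integral_le_lintegral_enorm _).trans ?_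
  have hd := (hbz z).sub (hbz z₀)
  have hdf := (hbf z).sub (hbf z₀)
  calc ∫⁻ x, ‖a x • b (foldMap t x + z) - a x • b (foldMap t x + z₀)‖ₑ
      = eLpNorm (a • fun x => b (foldMap t x + z) - b (foldMap t x + z₀)) 1 volume := by
        rw [eLpNorm_one_eq_lintegral_enorm]
        simp only [Pi.smul_apply', smul_sub]
    _ ≤ eLpNorm a 2 volume *
        eLpNorm (fun x => b (foldMap t x + z) - b (foldMap t x + z₀)) 2 volume :=
        eLpNorm_smul_le_mul_eLpNorm hdf.1 ha.1
    _ ≤ _ := by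
        refine mul_le_mul_right ?_ _
        have e : eLpNorm (fun x => b (foldMap t x + z) - b (foldMap t x + z₀)) 2 volume =
            eLpNorm (fun x => b (x + z) - b (x + z₀)) 2 (volume.map (foldMap t)) := by
          rw [eLpNorm_map_measure _ (continuous_foldMap t).aemeasurable]
          · rfl
          · rw [map_foldMap]
            exact (hd.1.restrict).smul_measure _
        rw [e, map_foldMap, eLpNorm_smul_measure_of_ne_top (by norm_num), smul_eq_mul]
        exact mul_le_mul_right (eLpNorm_mono_measure _ Measure.restrict_le_self) _

section Swap

variable {t : ℝ} {a ρ : Plane → ℝ} {b : Plane → ℂ}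

theorem integrable_prod_smul_foldMap (ha : Integrable a) (hac : HasCompactSupport a)
    (hρ : Continuous ρ) (hρc : HasCompactSupport ρ) (hb : MemLp b 2 volume) :
    Integrable (fun p : Plane × Plane => (a p.1 * ρ (p.2 - foldMap t p.1)) • b p.2)
      (volume.prod volume) := by
  obtain ⟨M, hM⟩ := hρ.bounded_above_of_compact_support hρc
  -- The integrand vanishes unless `y` lies in this compact set, on which the `L²` function `b` is
  -- integrable; a product then dominates.
  set K : Set Plane := (fun p : Plane × Plane => p.1 + foldMap t p.2) '' (tsupport ρ ×ˢ tsupport a)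
  have hK : IsCompact K := (hρc.isCompact.prod hac.isCompact).image
    (continuous_fst.add ((continuous_foldMap t).comp continuous_snd))
  have hbK : Integrable (K.indicator b) := by
    rw [integrable_indicator_iff hK.measurableSet]
    have : IsFiniteMeasure (volume.restrict K) := ⟨by simpa using hK.measure_lt_top⟩
    exact (hb.restrict K).integrable (by norm_num)
  have hdom : Integrable (fun p : Plane × Plane => (M * ‖a p.1‖) * ‖K.indicator b p.2‖)
      (volume.prod volume) := (ha.norm.const_mul M).mul_prod hbK.norm
  refine hdom.mono ?_ (ae_of_all _ fun p => ?_)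
  · have h1 : AEStronglyMeasurable (fun p : Plane × Plane => a p.1) (volume.prod volume) :=
      ha.1.comp_fst
    have h2 : AEStronglyMeasurable (fun p : Plane × Plane => b p.2) (volume.prod volume) :=
      hb.1.comp_snd
    have h3 : Continuous (fun p : Plane × Plane => ρ (p.2 - foldMap t p.1)) :=
      hρ.comp (continuous_snd.sub ((continuous_foldMap t).comp continuous_fst))
    exact (h1.mul h3.aestronglyMeasurable).smul h2
  · rw [norm_smul, norm_mul]
    by_cases h : a p.1 = 0 ∨ ρ (p.2 - foldMap t p.1) = 0
    · refine le_trans (le_of_eq ?_) (norm_nonneg _)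
      rcases h with h | h <;> simp [h]
    · push Not at h
      have hm : p.2 ∈ K := ⟨(p.2 - foldMap t p.1, p.1),
        ⟨subset_tsupport _ h.2, subset_tsupport _ h.1⟩, by simp⟩
      rw [Set.indicator_of_mem hm, Real.norm_of_nonneg (mul_nonneg (mul_nonneg
        ((norm_nonneg _).trans (hM 0)) (norm_nonneg _)) (norm_nonneg _)), mul_comm M]
      gcongr
      exact hM _

theorem integral_swap_foldMap (ha : Integrable a) (hac : HasCompactSupport a)
    (hρ : Continuous ρ) (hρc : HasCompactSupport ρ) (hb : MemLp b 2 volume) :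
    ∫ x, a x • ∫ y, ρ (y - foldMap t x) • b y =
      ∫ y, (∫ x, a x * ρ (y - foldMap t x)) • b y := by
  have h := integral_integral_swap (μ := (volume : Measure Plane)) (ν := (volume : Measure Plane))
    (f := fun x y => (a x * ρ (y - foldMap t x)) • b y)
    (integrable_prod_smul_foldMap ha hac hρ hρc hb)
  simp only [integral_smul_const] at h
  rw [← h]
  simp only [mul_smul, integral_smul]

theorem integral_smul_integral_foldMap_add (ha : Integrable a) (hac : HasCompactSupport a)
    (hρ : Continuous ρ) (hρc : HasCompactSupport ρ) (hb : MemLp b 2 volume) :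
    ∫ z, ρ z • ∫ x, a x • b (foldMap t x + z) =
      ∫ x, a x • ∫ y, ρ (y - foldMap t x) • b y := by
  have hmp : MeasurePreserving (fun p : Plane × Plane => (p.1, foldMap t p.1 + p.2))
      (volume.prod volume) (volume.prod volume) :=
    (MeasurePreserving.id (volume : Measure Plane)).skew_product
      (g := fun x z => foldMap t x + z)
      ((((continuous_foldMap t).comp continuous_fst).add continuous_snd).measurable)
      (ae_of_all _ fun x => (measurePreserving_add_left volume (foldMap t x)).map_eq)
  have hint := hmp.integrable_comp_of_integrable
    (integrable_prod_smul_foldMap (t := t) ha hac hρ hρc hb)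
  have h := integral_integral_swap (μ := (volume : Measure Plane)) (ν := (volume : Measure Plane))
    (f := fun x z => (a x * ρ z) • b (foldMap t x + z))
    (hint.congr (ae_of_all _ fun p => by simp [Function.comp, Function.uncurry]))
  have e1 : ∀ x, ∫ z, (a x * ρ z) • b (foldMap t x + z) =
      a x • ∫ y, ρ (y - foldMap t x) • b y := by
    intro x
    rw [← integral_add_left_eq_self (μ := volume) (fun y => ρ (y - foldMap t x) • b y)
      (foldMap t x), ← integral_smul]
    simp [mul_smul]
  simp only [e1] at h
  rw [h]
  congr 1
  funext z
  rw [← integral_smul]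
  congr 1
  funext x
  rw [smul_smul, mul_comm]

end Swap

theorem coe_sign_eq_div (a : ℝ) : ((SignType.sign a : SignType) : ℝ) = a / |a| := by
  rcases eq_or_ne a 0 with rfl | h
  · simp
  · rw [eq_div_iff (abs_ne_zero.2 h), sign_mul_abs]

theorem abs_coe_sign_le (a : ℝ) : |((SignType.sign a : SignType) : ℝ)| ≤ 1 := by
  rw [coe_sign_eq_div, abs_div, abs_abs]
  exact div_self_le_one _

theorem measurable_foldJac (t : ℝ) (i j : Fin 2) : Measurable fun x => foldJac t x i j := by
  fin_cases i <;> fin_cases j <;> simp only [foldJac, coe_sign_eq_div] <;> simp <;> fun_prop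

theorem abs_foldJac_le (t : ℝ) (x : Plane) (i j : Fin 2) : |foldJac t x i j| ≤ 1 + 2 * |t| := by
  have h0 := abs_nonneg t
  have h1 := abs_coe_sign_le (x 0)
  have h2 := abs_coe_sign_le (x 1 - t * |x 0|)
  fin_cases i <;> fin_cases j <;> simp [foldJac]
  · have h3 : |1 - ((SignType.sign (x 1 - t * |x 0|) : SignType) : ℝ)| ≤ 2 := by
      rw [abs_le] at h2 ⊢
      constructor <;> linarith
    nlinarith [mul_le_mul (mul_le_mul_of_nonneg_left h1 h0) h3 (abs_nonneg _) (by linarith)]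
  · linarith
  · linarith

/-- For `t ≥ 0` the wedge is a convex cone, and adding a point of its closure stays inside.
Therefore test functions on the wedge can be translated by values of the fold. -/
theorem add_mem_aboveCone {t : ℝ} (ht : 0 ≤ t) (x : Plane) {z : Plane}
    (hz : z ∈ (aboveCone t : Set Plane)) : z + foldMap t x ∈ (aboveCone t : Set Plane) := by
  rw [mem_aboveCone] at hz ⊢
  have h1 : t * |z 0 + x 0| ≤ t * |z 0| + t * |x 0| := by
    rw [← mul_add]
    exact mul_le_mul_of_nonneg_left (abs_add_le _ _) ht
  have h2 := abs_nonneg (x 1 - t * |x 0|)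
  simp only [PiLp.add_apply, foldMap_zero, foldMap_one]
  linarith

theorem IsTestFunction.sub_foldMap {t : ℝ} (ht : 0 ≤ t) {ρ : Plane → ℝ}
    (hρ : IsTestFunction (aboveCone t) ρ) (x : Plane) :
    IsTestFunction (aboveCone t) fun y => ρ (y - foldMap t x) where
  contDiff := hρ.contDiff.comp (contDiff_id.sub contDiff_const)
  hasCompactSupport := hρ.hasCompactSupport.comp_homeomorph (Homeomorph.subRight (foldMap t x))
  tsupport_subset := by
    intro y hy
    have h : y - foldMap t x ∈ tsupport ρ := by
      have := tsupport_comp_eq_preimage ρ (Homeomorph.subRight (foldMap t x))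
      change y ∈ tsupport (ρ ∘ Homeomorph.subRight (foldMap t x)) at hy
      rw [this] at hy
      exact hy
    simpa using add_mem_aboveCone ht x (hρ.tsupport_subset h)

theorem zero_mem_closure_aboveCone (t : ℝ) : (0 : Plane) ∈ closure (aboveCone t : Set Plane) := by
  have h : Tendsto (fun s : ℝ => s • (EuclideanSpace.single 1 1 : Plane)) (𝓝[>] 0) (𝓝 0) := by
    have : Continuous fun s : ℝ => s • (EuclideanSpace.single 1 1 : Plane) := by fun_prop
    simpa using (this.tendsto 0).mono_left nhdsWithin_le_nhds
  refine mem_closure_of_tendsto h ?_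
  filter_upwards [self_mem_nhdsWithin] with s hs
  rw [mem_aboveCone]
  simpa using hs

/-- The chain rule for the composition of an `H¹` function with the folding map. -/
theorem integral_fderiv_smul_foldMap {t : ℝ} (ht : 0 ≤ t) (f : H1 (aboveCone t)) {φ : Plane → ℝ}
    (hφ : ContDiff ℝ ∞ φ) (hφc : HasCompactSupport φ) (i : Fin 2) :
    ∫ x, fderiv ℝ φ x (EuclideanSpace.single i 1) • H1.fn f (foldMap t x) =
      - ∫ x, φ x • ∑ j, foldJac t x i j • H1.grad f (foldMap t x) j := by
  set Ω : Set Plane := (aboveCone t : Set Plane) with hΩ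
  have hΩm : MeasurableSet Ω := (aboveCone t).isOpen.measurableSet
  set u : Plane → ℂ := Ω.indicator (H1.fn f) with hu_def
  set g : Fin 2 → Plane → ℂ := fun j => Ω.indicator fun x => H1.grad f x j with hg_def
  have hu : MemLp u 2 volume := (memLp_indicator_iff_restrict hΩm).2 (Lp.memLp _)
  have hg : ∀ j, MemLp (g j) 2 volume := fun j =>
    (memLp_indicator_iff_restrict hΩm).2 (memLp_apply _ j)
  set a : Plane → ℝ := fun x => fderiv ℝ φ x (EuclideanSpace.single i 1) with ha_def
  set c : Fin 2 → Plane → ℝ := fun j x => φ x * foldJac t x i j with hc_def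
  have hac : Continuous a := (hφ.continuous_fderiv (by simp)).clm_apply continuous_const
  have has : HasCompactSupport a := hφc.fderiv_apply (𝕜 := ℝ) _
  have hcs : ∀ j, HasCompactSupport (c j) := fun j => hφc.mul_right
  have hcb : ∀ j (p : ℝ≥0∞), MemLp (c j) p volume := fun j p => by
    refine ((hφ.continuous.memLp_of_hasCompactSupport hφc (p := p)).const_mul
      (1 + 2 * |t|)).mono ((hφ.continuous.measurable.mul
        (measurable_foldJac t i j)).aestronglyMeasurable) (ae_of_all _ fun x => ?_)
    rw [hc_def, norm_mul, norm_mul, mul_comm, Real.norm_of_nonneg (by positivity : 0 ≤ 1 + 2 * |t|)]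
    exact mul_le_mul_of_nonneg_right (abs_foldJac_le t x i j) (norm_nonneg _)
  have haI : Integrable a := hac.integrable_of_hasCompactSupport has
  have hcI : ∀ j, Integrable (c j) := fun j => memLp_one_iff_integrable.1 (hcb j 1)
  -- The claim is `κ 0 = 0`. Shifting the fold by `z` and averaging against a test function `ρ` of
  -- `z` mollifies `f`, so that only smooth functions need to be composed with the fold.
  set κ : Plane → ℂ := fun z => (∫ x, a x • u (foldMap t x + z)) +
    ∑ j, ∫ x, c j x • g j (foldMap t x + z) with hκ
  have hκ1 : Continuous fun z : Plane => ∫ x, a x • u (foldMap t x + z) :=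
    continuous_integral_smul_foldMap_add t (hac.memLp_of_hasCompactSupport has) hu
  have hκ2 : ∀ j, Continuous fun z : Plane => ∫ x, c j x • g j (foldMap t x + z) := fun j =>
    continuous_integral_smul_foldMap_add t (hcb j 2) (hg j)
  have hκc : Continuous κ := hκ1.add (continuous_finsetSum _ fun j _ => hκ2 j)
  have key : ∀ ρ : Plane → ℝ, IsTestFunction (aboveCone t) ρ → ∫ z, ρ z • κ z = 0 := by
    intro ρ hρ
    have hρc := hρ.contDiff.continuous
    have hρs := hρ.hasCompactSupport
    have hI : ∀ {w : Plane → ℂ}, Continuous w → Integrable fun z => ρ z • w z := fun hw =>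
      (hρc.smul hw).integrable_of_hasCompactSupport hρs.smul_right
    have hd : ∀ j : Fin 2, Continuous fun x => fderiv ℝ ρ x (EuclideanSpace.single j 1) :=
      fun j => hρ.continuous_deriv j
    have hds : ∀ j : Fin 2, HasCompactSupport fun x => fderiv ℝ ρ x (EuclideanSpace.single j 1) :=
      fun j => hρs.fderiv_apply (𝕜 := ℝ) _
    -- The weak gradient is tested with a translate of `ρ`, which is still supported in the wedge.
    have e1 : ∀ j x, ∫ y, ρ (y - foldMap t x) • g j y =
        - ∫ y, fderiv ℝ ρ (y - foldMap t x) (EuclideanSpace.single j 1) • u y := by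
      intro j x
      have hw : IsWeakGradient (H1.fn f) (H1.grad f) := f.2
      have h := hw _ (hρ.sub_foldMap ht x) j
      have h1 : ∫ y, ρ (y - foldMap t x) • g j y =
          ∫ y in Ω, ρ (y - foldMap t x) • H1.grad f y j := by
        rw [← integral_indicator hΩm]
        congr 1
        funext y
        by_cases hy : y ∈ Ω <;> simp [hg_def, hy]
      have h2 : ∫ y, fderiv ℝ ρ (y - foldMap t x) (EuclideanSpace.single j 1) • u y =
          ∫ y in Ω, fderiv ℝ (fun y => ρ (y - foldMap t x)) y (EuclideanSpace.single j 1) •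
            H1.fn f y := by
        rw [← integral_indicator hΩm]
        congr 1
        funext y
        by_cases hy : y ∈ Ω <;> simp [hu_def, hy, fderiv_comp_sub]
      rw [h1, h2, h, neg_neg]
    -- The chain rule for the smooth function `v ↦ ρ (y - v)`; its inner derivative `-1` cancels the
    -- sign of the integration by parts.
    have e2 : ∀ y, ∫ x, a x * ρ (y - foldMap t x) =
        ∑ j, ∫ x, c j x * fderiv ℝ ρ (y - foldMap t x) (EuclideanSpace.single j 1) := by
      intro y
      have h := integral_fderiv_mul_comp_foldMap t hφ hφc (ψ := fun v => ρ (y - v))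
        (hρ.contDiff.comp (contDiff_const.sub contDiff_id))
        (hρs.comp_homeomorph (Homeomorph.subLeft y)) i
      rw [ha_def, h, ← integral_finsetSum, ← integral_neg]
      · congr 1
        funext x
        have hder : ∀ v : Plane, fderiv ℝ (fun v => ρ (y - v)) v = - fderiv ℝ ρ (y - v) :=
          fun v => by
          have := (hρ.contDiff.differentiable (by simp) (y - v)).hasFDerivAt.comp v
            ((hasFDerivAt_id v).const_sub y)
          refine this.fderiv.trans ?_
          ext w
          simp
        simp only [hder, hc_def, Finset.mul_sum, ← Finset.sum_neg_distrib,
          neg_apply]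
        refine Finset.sum_congr rfl fun j _ => ?_
        ring
      · intro j _
        obtain ⟨M, hM⟩ := (hd j).bounded_above_of_compact_support (hds j)
        exact (hcI j).mul_bdd ((hd j).comp
          (continuous_const.sub (continuous_foldMap t))).aestronglyMeasurable
          (ae_of_all _ fun x => hM _)
    have hI1 := hI hκ1
    have hI2 := fun j => hI (hκ2 j)
    calc ∫ z, ρ z • κ z
        = (∫ z, ρ z • ∫ x, a x • u (foldMap t x + z)) +
          ∑ j, ∫ z, ρ z • ∫ x, c j x • g j (foldMap t x + z) := by
          rw [← integral_finsetSum _ fun j _ => hI2 j,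
            ← integral_add hI1 (integrable_finsetSum _ fun j _ => hI2 j)]
          simp only [hκ, smul_add, Finset.smul_sum]
      _ = (∫ y, (∫ x, a x * ρ (y - foldMap t x)) • u y) +
          ∑ j, ∫ x, c j x • ∫ y, ρ (y - foldMap t x) • g j y := by
          rw [integral_smul_integral_foldMap_add haI has hρc hρs hu,
            integral_swap_foldMap haI has hρc hρs hu]
          simp only [fun j => integral_smul_integral_foldMap_add (t := t) (hcI j) (hcs j) hρc hρs
            (hg j)]
      _ = (∫ y, (∫ x, a x * ρ (y - foldMap t x)) • u y) - ∑ j, ∫ y, (∫ x, c j x *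
            fderiv ℝ ρ (y - foldMap t x) (EuclideanSpace.single j 1)) • u y := by
          simp only [e1, smul_neg, integral_neg, Finset.sum_neg_distrib, ← sub_eq_add_neg]
          simp only [fun j => integral_swap_foldMap (t := t) (hcI j) (hcs j) (hd j) (hds j) hu]
      _ = 0 := by
          rw [← integral_finsetSum, sub_eq_zero]
          · simp only [e2, Finset.sum_smul]
          · intro j _
            have := (integrable_prod_smul_foldMap (t := t) (hcI j) (hcs j) (hd j)
              (hds j) hu).integral_prod_right
            simpa only [integral_smul_const] using this
  -- Continuity of `κ` upgrades the averaged identity to a pointwise one on the wedge, and then to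
  -- the vertex, which lies in its closure.
  have hz : ∀ z ∈ Ω, κ z = 0 := by
    have hae := (aboveCone t).isOpen.ae_eq_zero_of_integral_contDiff_smul_eq_zero
      (μ := volume) (f := κ) (hκc.locallyIntegrable.locallyIntegrableOn _)
      (fun ρ h1 h2 h3 => key ρ ⟨h1, h2, h3⟩)
    have := Measure.eqOn_open_of_ae_eq (μ := volume) (f := κ) (g := fun _ => 0)
      ((ae_restrict_iff' hΩm).2 hae) (aboveCone t).isOpen hκc.continuousOn continuousOn_const
    exact this
  have h0 : κ 0 = 0 := by
    have hcl : IsClosed {z | κ z = 0} := isClosed_eq hκc continuous_const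
    exact closure_minimal (fun z hz' => hz z hz') hcl (zero_mem_closure_aboveCone t)
  have hmem : ∀ᵐ x : Plane, foldMap t x ∈ Ω := by
    filter_upwards [ae_snd_ne (c := fun a => t * |a|) (by fun_prop)] with x hx
    rw [hΩ, mem_aboveCone, foldMap_zero, foldMap_one]
    have := abs_pos.2 (sub_ne_zero.2 hx)
    linarith
  have f1 : ∫ x, a x • u (foldMap t x + 0) = ∫ x, a x • H1.fn f (foldMap t x) := by
    apply integral_congr_ae
    filter_upwards [hmem] with x hx
    simp [hu_def, hx]
  have f2 : ∑ j, ∫ x, c j x • g j (foldMap t x + 0) =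
      ∫ x, φ x • ∑ j, foldJac t x i j • H1.grad f (foldMap t x) j := by
    rw [← integral_finsetSum]
    · apply integral_congr_ae
      filter_upwards [hmem] with x hx
      simp only [add_zero, Finset.smul_sum, hc_def, mul_smul]
      refine Finset.sum_congr rfl fun j _ => ?_
      simp [hg_def, hx]
    · intro j _
      simp only [add_zero]
      exact memLp_one_iff_integrable.1
        ((memLp_comp_foldMap ((hg j).restrict _)).smul (hcb j 2) (r := 1))
  rw [hκ] at h0
  simp only [f1, f2] at h0
  exact eq_neg_of_add_eq_zero_left h0

/-! ### The reflection as an extension operator: the upper bound -/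

theorem foldJac_of_mem {t : ℝ} {x : Plane} (hx : x ∈ (aboveCone t : Set Plane)) (i j : Fin 2) :
    foldJac t x i j = (1 : Matrix (Fin 2) (Fin 2) ℝ) i j := by
  have h : (SignType.sign (x 1 - t * |x 0|) : SignType) = 1 := sign_pos (sub_pos.2 hx)
  fin_cases i <;> fin_cases j <;> simp [foldJac, h]

/-- Expand `(|y₀| + 2t |y₁|)² + |y₁|²` and use `4t |y₀| |y₁| ≤ 2t (|y₀|² + |y₁|²)`. The linear
coefficient `2t` is what produces `√2/4` in the theorem. -/
theorem sum_norm_sq_foldJac_le {t : ℝ} (ht : 0 ≤ t) {x : Plane} (hx : x 1 < t * |x 0|)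
    (y : EuclideanSpace ℂ (Fin 2)) :
    ∑ i, ‖∑ j, foldJac t x i j • y j‖ ^ 2 ≤ (1 + 2 * t + 4 * t ^ 2) * ∑ i, ‖y i‖ ^ 2 := by
  have h : (SignType.sign (x 1 - t * |x 0|) : SignType) = -1 := sign_neg (sub_neg.2 hx)
  have h1 : ‖∑ j, foldJac t x 1 j • y j‖ = ‖y 1‖ := by simp [foldJac, h]
  have h0 : ‖∑ j, foldJac t x 0 j • y j‖ ≤ ‖y 0‖ + 2 * t * ‖y 1‖ := by
    rw [Fin.sum_univ_two]
    refine (norm_add_le _ _).trans (add_le_add (by simp [foldJac]) ?_)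
    rw [norm_smul]
    refine mul_le_mul_of_nonneg_right ?_ (norm_nonneg _)
    have h2 := abs_coe_sign_le (x 0)
    have h3 : foldJac t x 0 1 = 2 * t * (SignType.sign (x 0) : SignType) := by
      simp [foldJac, h]
      ring
    rw [h3, Real.norm_eq_abs, abs_mul, abs_of_nonneg (by linarith : 0 ≤ 2 * t)]
    exact mul_le_of_le_one_right (by linarith) h2
  rw [(Fin.sum_univ_two _ : ∑ i, ‖∑ j, foldJac t x i j • y j‖ ^ 2 = _),
    (Fin.sum_univ_two _ : ∑ i, ‖y i‖ ^ 2 = _), h1]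
  have h2 := pow_le_pow_left₀ (norm_nonneg _) h0 2
  have h3 := mul_nonneg ht (sq_nonneg (‖y 0‖ - ‖y 1‖))
  have h4 := mul_nonneg (sq_nonneg t) (sq_nonneg ‖y 0‖)
  nlinarith

theorem enorm_sq_eq_ofReal {F : Type*} [NormedAddCommGroup F] (z : F) :
    ‖z‖ₑ ^ 2 = ENNReal.ofReal (‖z‖ ^ 2) := by
  rw [ENNReal.ofReal_pow (norm_nonneg _), ofReal_norm]

theorem sum_enorm_sq_foldJac_le {t : ℝ} (ht : 0 ≤ t) {x : Plane} (hx : x 1 < t * |x 0|)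
    (y : EuclideanSpace ℂ (Fin 2)) :
    ∑ i, ‖∑ j, foldJac t x i j • y j‖ₑ ^ 2 ≤
      ENNReal.ofReal (1 + 2 * t + 4 * t ^ 2) * ∑ i, ‖y i‖ₑ ^ 2 := by
  simp only [enorm_sq_eq_ofReal]
  rw [← ENNReal.ofReal_sum_of_nonneg fun i _ => sq_nonneg _,
    ← ENNReal.ofReal_sum_of_nonneg fun i _ => sq_nonneg _, ← ENNReal.ofReal_mul (by positivity)]
  exact ENNReal.ofReal_le_ofReal (sum_norm_sq_foldJac_le ht hx y)

theorem restrict_top_eq {d : ℕ} (μ : Measure (EuclideanSpace ℝ (Fin d))) :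
    μ.restrict ((⊤ : TopologicalSpace.Opens (EuclideanSpace ℝ (Fin d))) : Set _) = μ := by
  simp

theorem ae_restrict_top {d : ℕ} {μ : Measure (EuclideanSpace ℝ (Fin d))}
    {p : EuclideanSpace ℝ (Fin d) → Prop} :
    (∀ᵐ x ∂(μ.restrict ((⊤ : TopologicalSpace.Opens (EuclideanSpace ℝ (Fin d))) : Set _)), p x) ↔
      ∀ᵐ x ∂μ, p x := by
  rw [restrict_top_eq]

theorem setLIntegral_top {d : ℕ} (q : EuclideanSpace ℝ (Fin d) → ℝ≥0∞) :
    ∫⁻ x in ((⊤ : TopologicalSpace.Opens (EuclideanSpace ℝ (Fin d))) : Set _), q x = ∫⁻ x, q x := by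
  rw [restrict_top_eq]

theorem setIntegral_top {d : ℕ} (q : EuclideanSpace ℝ (Fin d) → ℂ) :
    ∫ x in ((⊤ : TopologicalSpace.Opens (EuclideanSpace ℝ (Fin d))) : Set _), q x = ∫ x, q x := by
  rw [restrict_top_eq]

/-- The reflection at the graph of `t |x₀|` extends every `H¹` function. -/
theorem exists_foldMap_extension {t : ℝ} (ht : 0 ≤ t) (f : H1 (aboveCone t)) :
    ∃ F : H1 (⊤ : TopologicalSpace.Opens Plane),
      (H1.fn F : Plane → ℂ) =ᵐ[volume] (fun x => H1.fn f (foldMap t x)) ∧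
      ∀ i, (fun x => H1.grad F x i) =ᵐ[volume]
        fun x => ∑ j, foldJac t x i j • H1.grad f (foldMap t x) j := by
  have h := H1.exists_of_integral_eq (Ω := (⊤ : TopologicalSpace.Opens Plane))
    (u := fun x => H1.fn f (foldMap t x))
    (g := fun i x => ∑ j, foldJac t x i j • H1.grad f (foldMap t x) j)
  simp only [restrict_top_eq] at h
  refine h (memLp_comp_foldMap (Lp.memLp _)) (fun i => ?_) fun φ hφ i =>
    integral_fderiv_smul_foldMap ht f hφ.contDiff hφ.hasCompactSupport i
  refine memLp_finsetSum _ fun j _ => ?_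
  have hm := memLp_comp_foldMap (memLp_apply (H1.grad f) j)
  refine (hm.const_smul (1 + 2 * |t|)).mono
    ((measurable_foldJac t i j).aestronglyMeasurable.smul hm.1) (ae_of_all _ fun x => ?_)
  rw [norm_smul, Pi.smul_apply, norm_smul,
    Real.norm_of_nonneg (by positivity : 0 ≤ 1 + 2 * |t|)]
  exact mul_le_mul_of_nonneg_right (abs_foldJac_le t x i j) (norm_nonneg _)

/-- The wedge contributes exactly `‖f‖²`, and its complement at most `(1 + 2t + 4t²) ‖f‖²`. -/
theorem norm_le_of_foldMap {t : ℝ} (ht : 0 ≤ t) {f : H1 (aboveCone t)}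
    {F : H1 (⊤ : TopologicalSpace.Opens Plane)}
    (h1 : (H1.fn F : Plane → ℂ) =ᵐ[volume] (fun x => H1.fn f (foldMap t x)))
    (h2 : ∀ i, (fun x => H1.grad F x i) =ᵐ[volume]
        fun x => ∑ j, foldJac t x i j • H1.grad f (foldMap t x) j) :
    ‖F‖ ≤ √(2 + 2 * t + 4 * t ^ 2) * ‖f‖ := by
  set q : Plane → ℝ≥0∞ := fun x => ‖H1.fn f x‖ₑ ^ 2 + ∑ i, ‖H1.grad f x i‖ₑ ^ 2 with hq
  have hqm : Measurable q := by
    refine ((Lp.stronglyMeasurable _).enorm.pow_const 2).add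
      (Finset.measurable_sum _ fun i _ => ?_)
    exact ((EuclideanSpace.proj (𝕜 := ℂ) i : EuclideanSpace ℂ (Fin 2) →L[ℂ] ℂ).continuous.measurable.comp
      (Lp.stronglyMeasurable (H1.grad f)).measurable).enorm.pow_const 2
  have hF : ‖F‖ₑ ^ 2 = ∫⁻ x, (‖H1.fn f (foldMap t x)‖ₑ ^ 2 +
      ∑ i, ‖∑ j, foldJac t x i j • H1.grad f (foldMap t x) j‖ₑ ^ 2) := by
    rw [H1.enorm_sq, setLIntegral_top]
    apply lintegral_congr_ae
    filter_upwards [h1, ae_all_iff.2 h2] with x hx1 hx2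
    simp only [hx1, hx2]
  have hf : ‖f‖ₑ ^ 2 = ∫⁻ x in (aboveCone t : Set Plane), q x := H1.enorm_sq f
  have hle : ‖F‖ₑ ^ 2 ≤ ENNReal.ofReal (2 + 2 * t + 4 * t ^ 2) * ‖f‖ₑ ^ 2 := by
    rw [hF, ← lintegral_add_compl _ (aboveCone t).isOpen.measurableSet]
    have e1 : ∫⁻ x in (aboveCone t : Set Plane), (‖H1.fn f (foldMap t x)‖ₑ ^ 2 +
        ∑ i, ‖∑ j, foldJac t x i j • H1.grad f (foldMap t x) j‖ₑ ^ 2) = ‖f‖ₑ ^ 2 := by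
      rw [hf]
      refine setLIntegral_congr_fun (aboveCone t).isOpen.measurableSet fun x hx => ?_
      simp only [foldJac_of_mem hx, foldMap_of_mem hx, hq]
      simp [Fin.sum_univ_two]
    have e2 : ∫⁻ x in (aboveCone t : Set Plane)ᶜ, (‖H1.fn f (foldMap t x)‖ₑ ^ 2 +
        ∑ i, ‖∑ j, foldJac t x i j • H1.grad f (foldMap t x) j‖ₑ ^ 2) ≤
        ENNReal.ofReal (1 + 2 * t + 4 * t ^ 2) * ‖f‖ₑ ^ 2 := by
      rw [hf, ← setLIntegral_compl_foldMap t hqm, ← lintegral_const_mul (f := fun x => q (foldMap t x)) _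
        (hqm.comp (continuous_foldMap t).measurable)]
      refine lintegral_mono_ae ?_
      rw [ae_restrict_iff' (aboveCone t).isOpen.measurableSet.compl]
      filter_upwards [ae_snd_ne (c := fun a => t * |a|) (by fun_prop)] with x hx hx'
      have hlt : x 1 < t * |x 0| := lt_of_le_of_ne (not_lt.1 hx') hx
      rw [hq, mul_add]
      refine add_le_add ?_ (sum_enorm_sq_foldJac_le ht hlt _)
      refine le_mul_of_one_le_left bot_le ?_
      rw [ENNReal.one_le_ofReal]
      nlinarith [sq_nonneg t]
    rw [e1]
    refine (add_le_add le_rfl e2).trans (le_of_eq ?_)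
    have e3 : (2 + 2 * t + 4 * t ^ 2) = 1 + (1 + 2 * t + 4 * t ^ 2) := by ring
    rw [e3, ENNReal.ofReal_add zero_le_one (by positivity), ENNReal.ofReal_one, add_mul, one_mul]
  have hr : ‖F‖ ^ 2 ≤ (2 + 2 * t + 4 * t ^ 2) * ‖f‖ ^ 2 := by
    rw [enorm_sq_eq_ofReal, enorm_sq_eq_ofReal, ← ENNReal.ofReal_mul (by positivity)] at hle
    exact (ENNReal.ofReal_le_ofReal_iff (by positivity)).1 hle
  rw [← Real.sqrt_sq (norm_nonneg f), ← Real.sqrt_mul (by positivity)]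
  exact Real.le_sqrt_of_sq_le hr

theorem exists_extensionOperator {t : ℝ} (ht : 0 ≤ t) :
    ∃ E : H1 (aboveCone t) →L[ℂ] H1 (⊤ : TopologicalSpace.Opens Plane),
      IsExtensionOperator E ∧ ‖E‖ ≤ √(2 + 2 * t + 4 * t ^ 2) := by
  choose F hF1 hF2 using exists_foldMap_extension ht
  -- The gradient is determined by the function, so linearity of the chosen extension can be checked
  -- on functions alone.
  have ext_of : ∀ {v w : H1 (⊤ : TopologicalSpace.Opens Plane)},
      (H1.fn v : Plane → ℂ) =ᵐ[volume] H1.fn w → v = w := by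
    intro v w h
    apply H1.fn_injective
    apply Lp.ext
    exact ae_restrict_top.2 h
  have hadd : ∀ f g, F (f + g) = F f + F g := by
    intro f g
    apply ext_of
    have h1 : (H1.fn (f + g) : Plane → ℂ) =ᵐ[volume.restrict (aboveCone t : Set Plane)]
        H1.fn f + H1.fn g := Lp.coeFn_add (H1.fn f) (H1.fn g)
    have h2 := ae_restrict_top.1 (Lp.coeFn_add (H1.fn (F f)) (H1.fn (F g)))
    filter_upwards [hF1 (f + g), hF1 f, hF1 g, ae_foldMap h1, h2] with x a1 a2 a3 a4 a5
    change _ = (H1.fn (F f) + H1.fn (F g) : L2 ⊤) x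
    rw [a5, Pi.add_apply, a1, a2, a3, a4, Pi.add_apply]
  have hsmul : ∀ (c : ℂ) f, F (c • f) = c • F f := by
    intro c f
    apply ext_of
    have h1 : (H1.fn (c • f) : Plane → ℂ) =ᵐ[volume.restrict (aboveCone t : Set Plane)]
        c • (H1.fn f : Plane → ℂ) := Lp.coeFn_smul c (H1.fn f)
    have h2 := ae_restrict_top.1 (Lp.coeFn_smul c (H1.fn (F f)))
    filter_upwards [hF1 (c • f), hF1 f, ae_foldMap h1, h2] with x a1 a2 a4 a5
    change _ = (c • H1.fn (F f) : L2 ⊤) x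
    rw [a5, Pi.smul_apply, a1, a2, a4, Pi.smul_apply]
  refine ⟨LinearMap.mkContinuous ⟨⟨F, hadd⟩, hsmul⟩ (√(2 + 2 * t + 4 * t ^ 2))
    fun f => norm_le_of_foldMap ht (hF1 f) (hF2 f), fun f => ?_,
    LinearMap.mkContinuous_norm_le _ (Real.sqrt_nonneg _) _⟩
  rw [Filter.EventuallyEq, ae_restrict_iff' (aboveCone t).isOpen.measurableSet]
  filter_upwards [hF1 f] with x hx hm
  rw [foldMap_of_mem hm] at hx
  exact hx

/-! ### Translating test functions against `H¹` functions -/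

section General

variable {d : ℕ} {Ω : TopologicalSpace.Opens (EuclideanSpace ℝ (Fin d))}

theorem H1.norm_fn_le (f : H1 Ω) : ‖H1.fn f‖ ≤ ‖f‖ :=
  abs_le_of_sq_le_sq' (by rw [H1.norm_sq f]; nlinarith [sq_nonneg ‖H1.grad f‖]) (norm_nonneg _) |>.2

theorem H1.norm_grad_le (f : H1 Ω) : ‖H1.grad f‖ ≤ ‖f‖ :=
  abs_le_of_sq_le_sq' (by rw [H1.norm_sq f]; nlinarith [sq_nonneg ‖H1.fn f‖]) (norm_nonneg _) |>.2

theorem H1.eLpNorm_fn_le (f : H1 Ω) :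
    eLpNorm (H1.fn f) 2 (volume.restrict (Ω : Set (EuclideanSpace ℝ (Fin d)))) ≤ ‖f‖ₑ := by
  rw [← Lp.enorm_def, ← ofReal_norm, ← ofReal_norm]
  exact ENNReal.ofReal_le_ofReal (H1.norm_fn_le f)

theorem H1.eLpNorm_grad_apply_le (f : H1 Ω) (i : Fin d) :
    eLpNorm (fun x => H1.grad f x i) 2
      (volume.restrict (Ω : Set (EuclideanSpace ℝ (Fin d)))) ≤ ‖f‖ₑ := by
  have h1 : eLpNorm (fun x => H1.grad f x i) 2
      (volume.restrict (Ω : Set (EuclideanSpace ℝ (Fin d)))) ≤ ‖H1.grad f‖ₑ := by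
    rw [Lp.enorm_def]
    exact eLpNorm_mono fun x => PiLp.norm_apply_le (H1.grad f x) i
  refine h1.trans ?_
  rw [← ofReal_norm, ← ofReal_norm]
  exact ENNReal.ofReal_le_ofReal (H1.norm_grad_le f)

theorem enorm_integral_smul_le {α : Type*} [MeasurableSpace α] {μ : Measure α} {k : α → ℝ}
    {v : α → ℂ} (hk : AEStronglyMeasurable k μ) (hv : AEStronglyMeasurable v μ) :
    ‖∫ x, k x • v x ∂μ‖ₑ ≤ eLpNorm k 2 μ * eLpNorm v 2 μ := by
  refine (enorm_integral_le_lintegral_enorm _).trans ?_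
  have h := eLpNorm_smul_le_mul_eLpNorm (p := 2) (q := 2) (r := 1) hv hk
  rw [eLpNorm_one_eq_lintegral_enorm] at h
  exact h

theorem norm_integral_smul_le_of_eLpNorm_le {α : Type*} [MeasurableSpace α] {μ : Measure α}
    {k : α → ℝ} {v : α → ℂ} (hk : MemLp k 2 μ) (hv : AEStronglyMeasurable v μ) {B : ℝ}
    (hB : 0 ≤ B) (h : eLpNorm v 2 μ ≤ ENNReal.ofReal B) :
    ‖∫ x, k x • v x ∂μ‖ ≤ (eLpNorm k 2 μ).toReal * B := by
  have h1 : ‖∫ x, k x • v x ∂μ‖ₑ ≤ eLpNorm k 2 μ * ENNReal.ofReal B :=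
    (enorm_integral_smul_le hk.1 hv).trans (mul_le_mul_right h _)
  rw [← ENNReal.ofReal_toReal hk.2.ne, ← ENNReal.ofReal_mul ENNReal.toReal_nonneg,
    ← ofReal_norm] at h1
  exact (ENNReal.ofReal_le_ofReal_iff (mul_nonneg ENNReal.toReal_nonneg hB)).1 h1

theorem IsTestFunction.comp_sub {h : EuclideanSpace ℝ (Fin d) → ℝ} (hh : IsTestFunction ⊤ h)
    (v : EuclideanSpace ℝ (Fin d)) : IsTestFunction ⊤ fun x => h (x - v) where
  contDiff := hh.contDiff.comp (contDiff_id.sub contDiff_const)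
  hasCompactSupport := hh.hasCompactSupport.comp_homeomorph (Homeomorph.subRight v)
  tsupport_subset := fun _ _ => trivial

theorem H1.integral_fderiv_smul (w : H1 (⊤ : TopologicalSpace.Opens (EuclideanSpace ℝ (Fin d))))
    {φ : EuclideanSpace ℝ (Fin d) → ℝ} (hφ : IsTestFunction ⊤ φ) (i : Fin d) :
    ∫ x, fderiv ℝ φ x (EuclideanSpace.single i 1) • H1.fn w x =
      - ∫ x, φ x • H1.grad w x i := by
  have hw : IsWeakGradient (H1.fn w) (H1.grad w) := w.2
  have h := hw φ hφ i
  rwa [setIntegral_top, setIntegral_top] at h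

theorem H1.hasDerivAt_integral_translate
    (w : H1 (⊤ : TopologicalSpace.Opens (EuclideanSpace ℝ (Fin d))))
    {h : EuclideanSpace ℝ (Fin d) → ℝ} (hh : IsTestFunction ⊤ h) (i : Fin d) (s : ℝ) :
    HasDerivAt (fun s : ℝ => ∫ x, h (x - s • EuclideanSpace.single i 1) • H1.fn w x)
      (∫ x, h (x - s • EuclideanSpace.single i 1) • H1.grad w x i) s := by
  set e : EuclideanSpace ℝ (Fin d) := EuclideanSpace.single i 1 with he
  set L : ℂ →L[ℝ] ℝ →L[ℝ] ℂ := (ContinuousLinearMap.lsmul ℝ ℝ).flip with hL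
  -- The pairing is the convolution of `H1.fn w` with the reflected function `k`, evaluated at `s •
  -- e`; the derivative falls on `k` and is then moved to `w`.
  set k : EuclideanSpace ℝ (Fin d) → ℝ := fun z => h (-z) with hk
  have hkd : ContDiff ℝ 1 k := (hh.contDiff.of_le (by simp)).comp contDiff_neg
  have hkc : HasCompactSupport k := hh.hasCompactSupport.comp_homeomorph (Homeomorph.neg _)
  have hloc : LocallyIntegrable (H1.fn w) volume := by
    have := (Lp.memLp (H1.fn w)).locallyIntegrable (by norm_num)
    simpa only [TopologicalSpace.Opens.coe_top, Measure.restrict_univ] using this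
  have h1 := hkc.hasFDerivAt_convolution_right L hloc hkd (s • e)
  have h2 := h1.comp_hasDerivAt s ((hasDerivAt_id s).smul_const e)
  have e1 : ∀ s : ℝ, (convolution (H1.fn w) k L volume) (s • e) =
      ∫ x, h (x - s • e) • H1.fn w x := by
    intro s
    rw [convolution]
    simp [hL, hk]
  have e2 : (convolution (H1.fn w) (fderiv ℝ k) (L.precompR _) volume) (s • e) e =
      ∫ x, h (x - s • e) • H1.grad w x i := by
    rw [convolution_precompR_apply L hloc (hkc.fderiv ℝ) (hkd.continuous_fderiv (by simp)),
      convolution]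
    have := H1.integral_fderiv_smul w (hh.comp_sub (s • e)) i
    rw [← neg_eq_iff_eq_neg] at this
    rw [← this, ← integral_neg]
    congr 1
    funext x
    have hd : fderiv ℝ k (s • e - x) e = - fderiv ℝ (fun x => h (x - s • e)) x e := by
      have h3 := (hh.contDiff.differentiable (by simp) (-(s • e - x))).hasFDerivAt.comp (s • e - x)
        ((hasFDerivAt_id (s • e - x)).neg)
      have h4 : fderiv ℝ k (s • e - x) = _ := h3.fderiv
      rw [h4, fderiv_comp_sub]
      simp
    rw [← he]
    simp [hL, hd]
  have h3 : HasDerivAt (fun s : ℝ => (convolution (H1.fn w) k L volume) (s • e))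
      ((convolution (H1.fn w) (fderiv ℝ k) (L.precompR _) volume) (s • e) e) s := by
    simpa [Function.comp_def] using h2
  rw [e2] at h3
  simpa only [e1] using h3

/-- Translating a test function changes its pairing with an `H¹` function only by a multiple of
the length of the translation. -/
theorem H1.norm_integral_sub_translate_le
    (w : H1 (⊤ : TopologicalSpace.Opens (EuclideanSpace ℝ (Fin d))))
    {h : EuclideanSpace ℝ (Fin d) → ℝ} (hh : IsTestFunction ⊤ h) (i : Fin d) {l : ℝ} (hl : 0 ≤ l) :
    ‖(∫ x, h (x - l • EuclideanSpace.single i 1) • H1.fn w x) - ∫ x, h x • H1.fn w x‖ ≤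
      (eLpNorm h 2 volume).toReal * ‖w‖ * l := by
  have hmem : MemLp h 2 volume :=
    hh.contDiff.continuous.memLp_of_hasCompactSupport hh.hasCompactSupport
  -- Mean value inequality on `[0, 1]` with shift `r * l`; Cauchy–Schwarz bounds the derivative,
  -- since shifting `h` keeps its `L²` norm.
  have h1 := norm_image_sub_le_of_norm_deriv_le_segment_01'
    (f := fun r : ℝ => ∫ x, h (x - (r * l) • EuclideanSpace.single i 1) • H1.fn w x)
    (f' := fun r : ℝ => l • ∫ x, h (x - (r * l) • EuclideanSpace.single i 1) • H1.grad w x i)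
    (C := (eLpNorm h 2 volume).toReal * ‖w‖ * l)
    (fun r _ => by
      have h2 := (H1.hasDerivAt_integral_translate w hh i (r * l)).scomp r
        ((hasDerivAt_id r).mul_const l)
      simpa [Function.comp_def] using h2.hasDerivWithinAt)
    (fun r _ => by
      rw [norm_smul, Real.norm_of_nonneg hl, mul_comm]
      refine mul_le_mul_of_nonneg_right ?_ hl
      have hmp := measurePreserving_sub_right (volume : Measure (EuclideanSpace ℝ (Fin d)))
        ((r * l) • EuclideanSpace.single i 1)
      have hg := H1.eLpNorm_grad_apply_le w i
      have hgm := (memLp_apply (H1.grad w) i).1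
      simp only [TopologicalSpace.Opens.coe_top, Measure.restrict_univ] at hg hgm
      rw [← ofReal_norm] at hg
      have h3 := norm_integral_smul_le_of_eLpNorm_le (hmem.comp_measurePreserving hmp) hgm
        (norm_nonneg _) hg
      rwa [eLpNorm_comp_measurePreserving hmem.1 hmp] at h3)
  simpa using h1

end General

/-! ### Smoothed logarithm and radial functions -/

/-- A smooth function which vanishes on `(-∞, 1/2]` and is `log u / 2` on `[1, ∞)`. -/
theorem exists_smooth_half_log : ∃ γ : ℝ → ℝ, ContDiff ℝ ∞ γ ∧ (∀ u ≤ 1 / 2, γ u = 0) ∧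
    (∀ u, 1 ≤ u → γ u = Real.log u / 2) ∧ ∀ u ≤ 1, |γ u| ≤ 1 / 2 := by
  set s : ℝ → ℝ := fun u => Real.smoothTransition (2 * u - 1) with hs
  -- An interpolation between `1` and `u` that stays above `1/2`, so its logarithm is smooth. The
  -- profile is later evaluated at multiples of `|x|²`, and half of `log |x|²` is `log |x|`.
  set m : ℝ → ℝ := fun u => s u * u + (1 - s u) with hm
  have hs0 : ∀ u ≤ 1 / 2, s u = 0 := fun u hu =>
    Real.smoothTransition.zero_of_nonpos (by linarith)
  have hs1 : ∀ u, 1 ≤ u → s u = 1 := fun u hu =>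
    Real.smoothTransition.one_of_one_le (by linarith)
  have hsn : ∀ u, 0 ≤ s u := fun u => Real.smoothTransition.nonneg _
  have hsl : ∀ u, s u ≤ 1 := fun u => Real.smoothTransition.le_one _
  have hmge : ∀ u, 1 / 2 ≤ m u := by
    intro u
    rcases le_total u (1 / 2) with h | h
    · simp only [hm, hs0 u h]
      norm_num
    · simp only [hm]
      nlinarith [hsn u, hsl u]
  have hmd : ContDiff ℝ ∞ m := by
    have : ContDiff ℝ ∞ s := Real.smoothTransition.contDiff.comp (by fun_prop)
    exact (this.mul contDiff_id).add (contDiff_const.sub this)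
  refine ⟨fun u => Real.log (m u) / 2,
    (hmd.log fun u => (by linarith [hmge u] : (0 : ℝ) < m u).ne').div_const 2, ?_, ?_, ?_⟩
  · intro u hu
    simp [hm, hs0 u hu]
  · intro u hu
    simp [hm, hs1 u hu]
  · intro u hu
    have h1 : m u ≤ 1 := by
      simp only [hm]
      nlinarith [hsn u, hsl u]
    have h2 : Real.log (m u) ≤ 0 := Real.log_nonpos (by linarith [hmge u]) h1
    have h3 : Real.log (1 / 2) ≤ Real.log (m u) := Real.log_le_log (by norm_num) (hmge u)
    have h4 : -1 ≤ Real.log (1 / 2) := by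
      rw [one_div, Real.log_inv]
      linarith [Real.log_two_lt_d9]
    rw [abs_le]
    constructor <;> linarith

section Radial

variable {g : ℝ → ℝ}

theorem IsTestFunction.partialDeriv {d : ℕ} {h : EuclideanSpace ℝ (Fin d) → ℝ}
    (hh : IsTestFunction ⊤ h) (i : Fin d) :
    IsTestFunction ⊤ fun x => fderiv ℝ h x (EuclideanSpace.single i 1) where
  contDiff := (hh.contDiff.fderiv_right (by simp)).clm_apply contDiff_const
  hasCompactSupport := hh.hasCompactSupport.fderiv_apply (𝕜 := ℝ) _
  tsupport_subset := fun _ _ => trivial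

theorem isTestFunction_radial {d : ℕ} (hg : ContDiff ℝ ∞ g) {c : ℝ} (hc : ∀ u, c < u → g u = 0) :
    IsTestFunction (⊤ : TopologicalSpace.Opens (EuclideanSpace ℝ (Fin d)))
      fun x => g (‖x‖ ^ 2) where
  contDiff := hg.comp (contDiff_norm_sq ℝ)
  hasCompactSupport := by
    refine HasCompactSupport.of_support_subset_isCompact (isCompact_closedBall 0 (√c)) ?_
    intro x hx
    rw [mem_closedBall_zero_iff]
    by_contra h
    refine hx (hc _ ?_)
    rcases le_total 0 c with h0 | h0
    · rw [← Real.sqrt_lt_sqrt_iff h0, Real.sqrt_sq (norm_nonneg _)]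
      exact not_le.1 h
    · rw [Real.sqrt_eq_zero_of_nonpos h0, not_le] at h
      have := pow_pos h 2
      linarith
  tsupport_subset := fun _ _ => trivial

theorem fderiv_radial {d : ℕ} (hg : Differentiable ℝ g) (x : EuclideanSpace ℝ (Fin d))
    (i : Fin d) : fderiv ℝ (fun x : EuclideanSpace ℝ (Fin d) => g (‖x‖ ^ 2)) x
      (EuclideanSpace.single i 1) = 2 * deriv g (‖x‖ ^ 2) * x i := by
  have h := (hg (‖x‖ ^ 2)).hasDerivAt.comp_hasFDerivAt x (hasStrictFDerivAt_norm_sq x).hasFDerivAt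
  have h2 := h.fderiv
  have e : (fun x : EuclideanSpace ℝ (Fin d) => g (‖x‖ ^ 2)) = g ∘ fun x => ‖x‖ ^ 2 := rfl
  rw [e, h2]
  simp [EuclideanSpace.inner_single_right]
  ring

theorem laplacian_radial {d : ℕ} (hg : ContDiff ℝ ∞ g) (x : EuclideanSpace ℝ (Fin d)) :
    ∑ i, fderiv ℝ (fun y : EuclideanSpace ℝ (Fin d) =>
      fderiv ℝ (fun x : EuclideanSpace ℝ (Fin d) => g (‖x‖ ^ 2)) y (EuclideanSpace.single i 1)) x
      (EuclideanSpace.single i 1) =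
      2 * d * deriv g (‖x‖ ^ 2) + 4 * ‖x‖ ^ 2 * deriv (deriv g) (‖x‖ ^ 2) := by
  have hd : Differentiable ℝ g := hg.differentiable (by simp)
  have hd' : Differentiable ℝ (deriv g) :=
    ((contDiff_infty_iff_deriv.1 hg).2).differentiable (by simp)
  have key : ∀ i : Fin d, fderiv ℝ (fun y : EuclideanSpace ℝ (Fin d) =>
      fderiv ℝ (fun x : EuclideanSpace ℝ (Fin d) => g (‖x‖ ^ 2)) y (EuclideanSpace.single i 1)) x
      (EuclideanSpace.single i 1) =
      2 * deriv g (‖x‖ ^ 2) + 4 * deriv (deriv g) (‖x‖ ^ 2) * x i ^ 2 := by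
    intro i
    simp only [fderiv_radial hd]
    have h1 : DifferentiableAt ℝ (fun y : EuclideanSpace ℝ (Fin d) => deriv g (‖y‖ ^ 2)) x :=
      (hd' _).comp x (hasStrictFDerivAt_norm_sq x).hasFDerivAt.differentiableAt
    have h2 : HasFDerivAt (fun y : EuclideanSpace ℝ (Fin d) => y i)
        (EuclideanSpace.proj i : EuclideanSpace ℝ (Fin d) →L[ℝ] ℝ) x :=
      (EuclideanSpace.proj i : EuclideanSpace ℝ (Fin d) →L[ℝ] ℝ).hasFDerivAt
    have h3 := ((h1.hasFDerivAt.const_mul 2).mul h2).fderiv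
    have e : (fun y : EuclideanSpace ℝ (Fin d) => 2 * deriv g (‖y‖ ^ 2) * y i) =
      (fun y => 2 * deriv g (‖y‖ ^ 2)) * fun y => y i := rfl
    rw [e, h3]
    simp [fderiv_radial hd']
    ring
  simp only [key, Finset.sum_add_distrib, ← Finset.mul_sum, EuclideanSpace.real_norm_sq_eq x]
  simp
  ring

end Radial

/-! ### Integrals over discs and wedges -/

theorem toReal_eLpNorm_le_of_bounded {k : Plane → ℝ} {M r : ℝ} (hM : 0 ≤ M) (hr : 0 ≤ r)
    (hk : ∀ x, |k x| ≤ M) (hs : ∀ x, r < ‖x‖ → k x = 0) :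
    (eLpNorm k 2 volume).toReal ≤ 2 * M * r := by
  have hsub : Function.support k ⊆ Metric.closedBall 0 r := by
    intro x hx
    rw [mem_closedBall_zero_iff]
    by_contra h
    exact hx (hs x (not_le.1 h))
  have h1 : eLpNorm k 2 volume ≤ ENNReal.ofReal (2 * M * r) := by
    rw [← eLpNorm_restrict_eq_of_support_subset hsub]
    refine (eLpNorm_le_of_ae_bound (C := M) (ae_of_all _ hk)).trans ?_
    rw [Measure.restrict_apply_univ, EuclideanSpace.volume_closedBall_fin_two]
    have h2 : (ENNReal.ofReal r ^ 2 * ENNReal.ofReal Real.pi) ^ (2 : ℝ≥0∞).toReal⁻¹ ≤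
        ENNReal.ofReal (2 * r) := by
      have h4 : (ENNReal.ofReal r ^ 2 * ENNReal.ofReal Real.pi) ≤ ENNReal.ofReal (2 * r) ^ (2 : ℝ) := by
        have h5 : ENNReal.ofReal Real.pi ≤ ENNReal.ofReal 4 :=
          ENNReal.ofReal_le_ofReal Real.pi_le_four
        refine (mul_le_mul_right h5 _).trans (le_of_eq ?_)
        rw [ENNReal.rpow_two, ← ENNReal.ofReal_pow hr, ← ENNReal.ofReal_pow (by positivity),
          ← ENNReal.ofReal_mul (by positivity)]
        congr 1
        ring
      refine (ENNReal.rpow_le_rpow h4 (by positivity)).trans (le_of_eq ?_)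
      rw [← ENNReal.rpow_mul]
      simp
    refine (mul_le_mul_left h2 _).trans (le_of_eq ?_)
    rw [← ENNReal.ofReal_mul (by positivity)]
    congr 1
    ring
  exact ENNReal.toReal_le_of_le_ofReal (by positivity) h1

theorem lintegral_plane_eq_polar (q : Plane → ℝ≥0∞) :
    ∫⁻ x, q x = ∫⁻ p in polarCoord.target,
      ENNReal.ofReal p.1 * q (planeEquiv.symm (polarCoord.symm p)) := by
  rw [← measurePreserving_planeEquiv.symm.lintegral_comp_emb planeEquiv.symm.measurableEmbedding,
    ← lintegral_comp_polarCoord_symm]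
  rfl

theorem norm_planeEquiv_symm_polarCoord_symm {p : ℝ × ℝ} (hp : 0 ≤ p.1) :
    ‖planeEquiv.symm (polarCoord.symm p)‖ = p.1 := by
  rw [planeEquiv_symm_apply, polarCoord_symm_apply, EuclideanSpace.norm_eq, Fin.sum_univ_two]
  simp only [Real.norm_eq_abs, sq_abs]
  have : (p.1 * Real.cos p.2) ^ 2 + (p.1 * Real.sin p.2) ^ 2 = p.1 ^ 2 := by
    linear_combination p.1 ^ 2 * Real.sin_sq_add_cos_sq p.2
  simpa [this] using Real.sqrt_sq hp

theorem lintegral_polar_prod {p : ℝ → ℝ≥0∞} (hp : Measurable p) {S : Set ℝ}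
    (hS : MeasurableSet S) :
    ∫⁻ z in polarCoord.target, ENNReal.ofReal z.1 * p z.1 * S.indicator 1 z.2 =
      volume (S ∩ Set.Ioo (-Real.pi) Real.pi) * ∫⁻ r in Set.Ioi (0 : ℝ), ENNReal.ofReal r * p r := by
  rw [polarCoord_target, Measure.volume_eq_prod, ← Measure.prod_restrict,
    lintegral_prod_mul (f := fun r => ENNReal.ofReal r * p r) (g := S.indicator 1)
      (ENNReal.measurable_ofReal.mul hp).aemeasurable
      ((measurable_one.indicator hS).aemeasurable), lintegral_indicator_one hS,
    Measure.restrict_apply hS, mul_comm]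

theorem lintegral_norm_eq {p : ℝ → ℝ≥0∞} (hp : Measurable p) :
    ∫⁻ x : Plane, p ‖x‖ =
      ENNReal.ofReal (2 * Real.pi) * ∫⁻ r in Set.Ioi (0 : ℝ), ENNReal.ofReal r * p r := by
  have h := lintegral_polar_prod hp MeasurableSet.univ
  rw [Set.univ_inter, Real.volume_Ioo] at h
  rw [show 2 * Real.pi = Real.pi - -Real.pi by ring, ← h, lintegral_plane_eq_polar]
  refine setLIntegral_congr_fun polarCoord.open_target.measurableSet fun z hz => ?_
  have hz0 : 0 ≤ z.1 := le_of_lt hz.1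
  simp only [norm_planeEquiv_symm_polarCoord_symm hz0, Set.indicator_univ, Pi.one_apply, mul_one]

/-- Multiplied by `cos (θ/2)`, the hypothesis says that `sin (α - θ/2)` and `sin (α + θ/2)` are both
positive. -/
theorem angle_mem_Ioo {θ α : ℝ} (hθ : 0 < θ) (hθπ : θ < Real.pi)
    (hα : α ∈ Set.Ioo (-Real.pi) Real.pi)
    (h : Real.tan (θ / 2) * |Real.cos α| < Real.sin α) :
    α ∈ Set.Ioo (θ / 2) (Real.pi - θ / 2) := by
  have hc : 0 < Real.cos (θ / 2) := Real.cos_pos_of_mem_Ioo ⟨by linarith, by linarith⟩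
  have hs : 0 < Real.sin (θ / 2) := Real.sin_pos_of_pos_of_lt_pi (by linarith) (by linarith)
  have ht : 0 ≤ Real.tan (θ / 2) := by
    rw [Real.tan_eq_sin_div_cos]
    positivity
  have hsin : 0 < Real.sin α := lt_of_le_of_lt (mul_nonneg ht (abs_nonneg _)) h
  have hα0 : 0 < α := by
    by_contra h0
    exact absurd (Real.sin_nonpos_of_nonpos_of_neg_pi_le (not_lt.1 h0) hα.1.le) (not_le.2 hsin)
  have h1 : Real.sin (θ / 2) * |Real.cos α| < Real.cos (θ / 2) * Real.sin α := by
    rw [Real.tan_eq_sin_div_cos, div_mul_eq_mul_div, div_lt_iff₀ hc] at h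
    linarith
  have h2 := mul_le_mul_of_nonneg_left (le_abs_self (Real.cos α)) hs.le
  have h3 := mul_le_mul_of_nonneg_left (neg_le_abs (Real.cos α)) hs.le
  have h4 : 0 < Real.sin (α - θ / 2) := by
    rw [Real.sin_sub]
    linarith
  have h5 : 0 < Real.sin (α + θ / 2) := by
    rw [Real.sin_add]
    linarith
  constructor
  · by_contra h0
    exact absurd (Real.sin_nonpos_of_nonpos_of_neg_pi_le (x := α - θ / 2)
      (by linarith) (by linarith)) (not_le.2 h4)
  · by_contra h0
    have h6 := Real.sin_nonneg_of_nonneg_of_le_pi (x := α + θ / 2 - Real.pi)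
      (by linarith) (by linarith [hα.2])
    rw [Real.sin_sub_pi] at h6
    linarith

/-- In polar coordinates a radial integrand sees the wedge only through its angle `π - θ`. The
inequality suffices, so only one inclusion of angles is needed. -/
theorem setLIntegral_aboveCone_norm_le {θ : ℝ} (hθ : 0 < θ) (hθπ : θ < Real.pi) {p : ℝ → ℝ≥0∞}
    (hp : Measurable p) :
    ∫⁻ x in (aboveCone (Real.tan (θ / 2)) : Set Plane), p ‖x‖ ≤
      ENNReal.ofReal ((Real.pi - θ) / (2 * Real.pi)) * ∫⁻ x : Plane, p ‖x‖ := by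
  set S : Set ℝ := Set.Ioo (θ / 2) (Real.pi - θ / 2)
  have h := lintegral_polar_prod hp (S := S) measurableSet_Ioo
  have hv : volume (S ∩ Set.Ioo (-Real.pi) Real.pi) ≤ ENNReal.ofReal (Real.pi - θ) := by
    refine (measure_mono Set.inter_subset_left).trans (le_of_eq ?_)
    rw [Real.volume_Ioo]
    congr 1
    ring
  rw [lintegral_norm_eq hp, ← mul_assoc,
    ← ENNReal.ofReal_mul (div_nonneg (by linarith) (by positivity)),
    div_mul_cancel₀ _ (by positivity)]
  refine le_trans ?_ (mul_le_mul_left hv _)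
  rw [← h, ← lintegral_indicator (aboveCone _).isOpen.measurableSet, lintegral_plane_eq_polar]
  refine setLIntegral_mono' polarCoord.open_target.measurableSet fun z hz => ?_
  have hz0 : 0 < z.1 := hz.1
  by_cases hm : planeEquiv.symm (polarCoord.symm z) ∈ (aboveCone (Real.tan (θ / 2)) : Set Plane)
  · have hS : z.2 ∈ S := by
      refine angle_mem_Ioo hθ hθπ hz.2 ?_
      rw [mem_aboveCone, planeEquiv_symm_apply, polarCoord_symm_apply] at hm
      have hm' : Real.tan (θ / 2) * |z.1 * Real.cos z.2| < z.1 * Real.sin z.2 := hm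
      rw [abs_mul, abs_of_pos hz0] at hm'
      refine lt_of_mul_lt_mul_left ?_ hz0.le
      linarith
    rw [Set.indicator_of_mem hm, Set.indicator_of_mem hS,
      norm_planeEquiv_symm_polarCoord_symm hz0.le]
    simp
  · rw [Set.indicator_of_notMem hm, mul_zero]
    exact bot_le

theorem ofReal_log_le_lintegral_norm {p : ℝ → ℝ≥0∞} (hp : Measurable p) {r₀ r₁ : ℝ} (h0 : 0 < r₀)
    (h01 : r₀ ≤ r₁) (h : ∀ r ∈ Set.Ioo r₀ r₁, ENNReal.ofReal (1 / r ^ 2) ≤ p r) :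
    ENNReal.ofReal (2 * Real.pi * Real.log (r₁ / r₀)) ≤ ∫⁻ x : Plane, p ‖x‖ := by
  rw [lintegral_norm_eq hp, ENNReal.ofReal_mul (by positivity)]
  refine mul_le_mul_right ?_ _
  have hint : IntegrableOn (fun r : ℝ => r⁻¹) (Set.Ioc r₀ r₁) := by
    rw [← intervalIntegrable_iff_integrableOn_Ioc_of_le h01]
    exact intervalIntegral.intervalIntegrable_inv (fun x hx => by
      rw [Set.uIcc_of_le h01] at hx
      exact (h0.trans_le hx.1).ne') continuousOn_id
  calc ENNReal.ofReal (Real.log (r₁ / r₀))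
      = ENNReal.ofReal (∫ r in Set.Ioc r₀ r₁, r⁻¹) := by
        rw [← intervalIntegral.integral_of_le h01,
          integral_inv_of_pos h0 (lt_of_lt_of_le h0 h01)]
    _ = ∫⁻ r in Set.Ioc r₀ r₁, ENNReal.ofReal r⁻¹ := by
        rw [ofReal_integral_eq_lintegral_ofReal hint]
        filter_upwards [ae_restrict_mem measurableSet_Ioc] with r hr
        exact inv_nonneg.2 (h0.trans hr.1).le
    _ = ∫⁻ r in Set.Ioo r₀ r₁, ENNReal.ofReal r⁻¹ := setLIntegral_congr Ioo_ae_eq_Ioc.symm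
    _ ≤ ∫⁻ r in Set.Ioo r₀ r₁, ENNReal.ofReal r * p r := by
        refine setLIntegral_mono' measurableSet_Ioo fun r hr => ?_
        have hr0 : 0 < r := h0.trans hr.1
        refine le_trans (le_of_eq ?_) (mul_le_mul_right (h r hr) _)
        rw [← ENNReal.ofReal_mul hr0.le]
        congr 1
        field_simp
    _ ≤ ∫⁻ r in Set.Ioi (0 : ℝ), ENNReal.ofReal r * p r :=
        lintegral_mono_set fun r hr => h0.trans hr.1

/-! ### Test functions as elements of `H¹` -/

section TestFunctions

variable {d : ℕ}

theorem integral_fderiv_smul_ofReal {φ G : EuclideanSpace ℝ (Fin d) → ℝ}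
    (hφ : IsTestFunction ⊤ φ) (hG : IsTestFunction ⊤ G) (i : Fin d) :
    ∫ x, fderiv ℝ φ x (EuclideanSpace.single i 1) • (G x : ℂ) =
      - ∫ x, φ x • ((fderiv ℝ G x (EuclideanSpace.single i 1) : ℝ) : ℂ) := by
  have hφd := (hφ.partialDeriv i).contDiff.continuous
  have hGd := (hG.partialDeriv i).contDiff.continuous
  have hφc := hφ.contDiff.continuous
  have hGc := hG.contDiff.continuous
  have h := integral_mul_fderiv_eq_neg_fderiv_mul_of_integrable
    (μ := (volume : Measure (EuclideanSpace ℝ (Fin d)))) (f := φ) (g := G)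
    (v := EuclideanSpace.single i (1 : ℝ))
    ((hφd.mul hGc).integrable_of_hasCompactSupport hG.hasCompactSupport.mul_left)
    ((hφc.mul hGd).integrable_of_hasCompactSupport hφ.hasCompactSupport.mul_right)
    ((hφc.mul hGc).integrable_of_hasCompactSupport hφ.hasCompactSupport.mul_right)
    (fun x _ => hφ.contDiff.differentiable (by simp) x)
    (fun x _ => hG.contDiff.differentiable (by simp) x)
  have e1 : ∀ x, fderiv ℝ φ x (EuclideanSpace.single i 1) • (G x : ℂ) =
      ((fderiv ℝ φ x (EuclideanSpace.single i 1) * G x : ℝ) : ℂ) := fun x => by simp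
  have e2 : ∀ x, φ x • ((fderiv ℝ G x (EuclideanSpace.single i 1) : ℝ) : ℂ) =
      ((φ x * fderiv ℝ G x (EuclideanSpace.single i 1) : ℝ) : ℂ) := fun x => by simp
  simp only [e1, e2]
  rw [integral_complex_ofReal, integral_complex_ofReal, h]
  push_cast
  rw [neg_neg]

theorem memLp_ofReal {G : EuclideanSpace ℝ (Fin d) → ℝ} (hG : IsTestFunction ⊤ G) :
    MemLp (fun x => (G x : ℂ)) 2 volume :=
  (hG.contDiff.continuous.memLp_of_hasCompactSupport hG.hasCompactSupport (p := 2)).ofReal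

/-- A smooth compactly supported function restricts to an element of `H¹(Ω)`. -/
theorem IsTestFunction.exists_H1 {G : EuclideanSpace ℝ (Fin d) → ℝ} (hG : IsTestFunction ⊤ G)
    (Ω : TopologicalSpace.Opens (EuclideanSpace ℝ (Fin d))) :
    ∃ f : H1 Ω,
      H1.fn f =ᵐ[volume.restrict (Ω : Set (EuclideanSpace ℝ (Fin d)))] (fun x => (G x : ℂ)) ∧
      ∀ i, (fun x => H1.grad f x i) =ᵐ[volume.restrict (Ω : Set (EuclideanSpace ℝ (Fin d)))]
        fun x => ((fderiv ℝ G x (EuclideanSpace.single i 1) : ℝ) : ℂ) := by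
  refine H1.exists_of_integral_eq ((memLp_ofReal hG).restrict _)
    (fun i => (memLp_ofReal (hG.partialDeriv i)).restrict _) fun φ hφ i => ?_
  rw [setIntegral_eq_integral_of_forall_compl_eq_zero,
    setIntegral_eq_integral_of_forall_compl_eq_zero]
  · exact integral_fderiv_smul_ofReal
      ⟨hφ.contDiff, hφ.hasCompactSupport, fun _ _ => trivial⟩ hG i
  · intro x hx
    rw [image_eq_zero_of_notMem_tsupport fun hx' => hx (hφ.tsupport_subset hx'), zero_smul]
  · intro x hx
    have : x ∉ tsupport (fderiv ℝ φ) := fun hx' =>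
      hx (hφ.tsupport_subset (tsupport_fderiv_subset ℝ hx'))
    rw [image_eq_zero_of_notMem_tsupport this]
    simp

theorem H1.enorm_sq_of_testFunction {Ω : TopologicalSpace.Opens (EuclideanSpace ℝ (Fin d))}
    {G : EuclideanSpace ℝ (Fin d) → ℝ} {f : H1 Ω}
    (h1 : H1.fn f =ᵐ[volume.restrict (Ω : Set (EuclideanSpace ℝ (Fin d)))] (fun x => (G x : ℂ)))
    (h2 : ∀ i, (fun x => H1.grad f x i) =ᵐ[volume.restrict (Ω : Set (EuclideanSpace ℝ (Fin d)))]
        fun x => ((fderiv ℝ G x (EuclideanSpace.single i 1) : ℝ) : ℂ)) :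
    ‖f‖ₑ ^ 2 = ∫⁻ x in (Ω : Set (EuclideanSpace ℝ (Fin d))),
      ENNReal.ofReal (G x ^ 2 + ∑ i, fderiv ℝ G x (EuclideanSpace.single i 1) ^ 2) := by
  rw [H1.enorm_sq]
  apply lintegral_congr_ae
  filter_upwards [h1, ae_all_iff.2 h2] with x hx1 hx2
  simp only [hx1, hx2, enorm_sq_eq_ofReal]
  rw [ENNReal.ofReal_add (sq_nonneg _) (Finset.sum_nonneg fun i _ => sq_nonneg _),
    ENNReal.ofReal_sum_of_nonneg fun i _ => sq_nonneg _]
  simp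

/-- Green's formula: the inner product is the pairing of `G - ΔG` with `w`, which no longer involves
the gradient of `w`. -/
theorem H1.inner_testFunction_eq {G : EuclideanSpace ℝ (Fin d) → ℝ} (hG : IsTestFunction ⊤ G)
    {f w : H1 (⊤ : TopologicalSpace.Opens (EuclideanSpace ℝ (Fin d)))}
    (h1 : H1.fn f =ᵐ[volume.restrict ((⊤ : TopologicalSpace.Opens (EuclideanSpace ℝ (Fin d))) :
      Set (EuclideanSpace ℝ (Fin d)))] (fun x => (G x : ℂ)))
    (h2 : ∀ i, (fun x => H1.grad f x i) =ᵐ[volume.restrict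
      ((⊤ : TopologicalSpace.Opens (EuclideanSpace ℝ (Fin d))) : Set (EuclideanSpace ℝ (Fin d)))]
        fun x => ((fderiv ℝ G x (EuclideanSpace.single i 1) : ℝ) : ℂ)) :
    inner ℂ f w = (∫ x, G x • H1.fn w x) -
      ∫ x, (∑ i, fderiv ℝ (fun y => fderiv ℝ G y (EuclideanSpace.single i 1)) x
        (EuclideanSpace.single i 1)) • H1.fn w x := by
  have e1 : ∫ x in (⊤ : TopologicalSpace.Opens (EuclideanSpace ℝ (Fin d))),
      inner ℂ (H1.fn f x) (H1.fn w x) = ∫ x, G x • H1.fn w x := by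
    rw [← setIntegral_top]
    apply integral_congr_ae
    filter_upwards [h1] with x hx
    rw [hx]
    simp [mul_comm]
  have e2 : ∀ i, ∫ x in (⊤ : TopologicalSpace.Opens (EuclideanSpace ℝ (Fin d))),
      inner ℂ (H1.grad f x i) (H1.grad w x i) =
      - ∫ x, fderiv ℝ (fun y => fderiv ℝ G y (EuclideanSpace.single i 1)) x
        (EuclideanSpace.single i 1) • H1.fn w x := by
    intro i
    rw [H1.integral_fderiv_smul w (hG.partialDeriv i) i, neg_neg, ← setIntegral_top]
    apply integral_congr_ae
    filter_upwards [h2 i] with x hx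
    rw [hx]
    simp [mul_comm]
  rw [H1.inner_eq, e1, sub_eq_add_neg]
  simp only [e2, Finset.sum_neg_distrib, Finset.sum_smul]
  rw [integral_finsetSum]
  intro i _
  have hh := (hG.partialDeriv i).partialDeriv i
  have hint := integrable_smul hh.contDiff.continuous hh.hasCompactSupport (Lp.memLp (H1.fn w))
  simpa only [TopologicalSpace.Opens.coe_top, Measure.restrict_univ] using hint

end TestFunctions

/-! ### Logarithmic test functions almost orthogonal to functions vanishing on the wedge -/

/-- Pairing an `H¹` function which vanishes on `aboveCone t` with a test function concentrated
near the origin. -/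
theorem norm_integral_smul_le_of_vanishing {t : ℝ} (ht : 0 ≤ t)
    {w : H1 (⊤ : TopologicalSpace.Opens Plane)}
    (hw : ∀ᵐ x : Plane, x ∈ (aboveCone t : Set Plane) → H1.fn w x = 0) {h : Plane → ℝ}
    (hh : IsTestFunction ⊤ h) {l M : ℝ} (hl : 0 < l) (hM : 0 ≤ M) (hb : ∀ x, |h x| ≤ l ^ 2 * M)
    (hs : ∀ x, 1 / l < ‖x‖ → h x = 0) :
    ‖∫ x, h x • H1.fn w x‖ ≤ 2 * (t + 2) * M * ‖w‖ := by
  -- Raised by `(t + 2)/l`, the disc of radius `1/l` lies in the wedge: there `x₁ ≥ (t + 1)/l > t/l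
  -- ≥ t |x₀|`.
  have h0 : ∫ x, h (x - ((t + 2) / l) • EuclideanSpace.single 1 1) • H1.fn w x = 0 := by
    apply integral_eq_zero_of_ae
    filter_upwards [hw] with x hx
    by_cases hx' : x ∈ (aboveCone t : Set Plane)
    · simp [hx hx']
    · have : h (x - ((t + 2) / l) • EuclideanSpace.single 1 1) = 0 := by
        apply hs
        by_contra hle
        push Not at hle
        apply hx'
        have a0 := (PiLp.norm_apply_le (x - ((t + 2) / l) • EuclideanSpace.single 1 (1 : ℝ)) 0).trans hle
        have a1 := (PiLp.norm_apply_le (x - ((t + 2) / l) • EuclideanSpace.single 1 (1 : ℝ)) 1).trans hle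
        simp only [PiLp.sub_apply, PiLp.smul_apply, PiLp.single_apply, Real.norm_eq_abs]
          at a0 a1
        simp only [zero_ne_one, if_false, if_true, mul_zero, sub_zero, smul_eq_mul, mul_one]
          at a0 a1
        rw [mem_aboveCone]
        have a2 := (abs_le.1 a1).1
        have a3 := mul_le_mul_of_nonneg_left a0 ht
        have a4 : (t + 2) / l = t * (1 / l) + 2 * (1 / l) := by ring
        have a5 : 0 < 1 / l := by positivity
        linarith
      simp [this]
  have h1 := H1.norm_integral_sub_translate_le w hh 1 (l := (t + 2) / l) (by positivity)
  rw [h0, zero_sub, norm_neg] at h1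
  have h2 := toReal_eLpNorm_le_of_bounded (k := h) (M := l ^ 2 * M) (r := 1 / l) (by positivity)
    (by positivity) hb hs
  refine h1.trans ?_
  -- Scale invariance: the `L²` norm is of order `l` and the shift of order `1/l`.
  calc (eLpNorm h 2 volume).toReal * ‖w‖ * ((t + 2) / l)
      ≤ (2 * (l ^ 2 * M) * (1 / l)) * ‖w‖ * ((t + 2) / l) := by gcongr
    _ = 2 * (t + 2) * M * ‖w‖ := by
        field_simp

theorem deriv_eq_of_half_log {γ : ℝ → ℝ} (h : ∀ u, 1 ≤ u → γ u = Real.log u / 2) {v : ℝ}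
    (hv : 1 < v) : deriv γ v = 1 / (2 * v) := by
  have he : γ =ᶠ[𝓝 v] fun u => Real.log u / 2 := by
    filter_upwards [lt_mem_nhds hv] with u hu
    exact h u hu.le
  rw [he.deriv_eq, deriv_div_const, Real.deriv_log]
  field_simp

theorem deriv_deriv_eq_of_half_log {γ : ℝ → ℝ} (h : ∀ u, 1 ≤ u → γ u = Real.log u / 2) {v : ℝ}
    (hv : 1 < v) : deriv (deriv γ) v = -1 / (2 * v ^ 2) := by
  have he : deriv γ =ᶠ[𝓝 v] fun u => u⁻¹ / 2 := by
    filter_upwards [lt_mem_nhds hv] with u hu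
    rw [deriv_eq_of_half_log h hu]
    field_simp
  rw [he.deriv_eq, deriv_div_const, deriv_inv]
  field_simp

section LogProfile

variable {γ : ℝ → ℝ} {a b c : ℝ}

/-- The weights `A` and `B` allow a second application, to the derivative of the profile. -/
theorem hasDerivAt_logProfile {γ' : ℝ → ℝ} {s s' A B : ℝ} (h : ∀ u, HasDerivAt γ (γ' u) u) (u : ℝ) :
    HasDerivAt (fun u => A * γ (s * u) - B * γ (s' * u) + c)
      (A * s * γ' (s * u) - B * s' * γ' (s' * u)) u := by
  have h1 : ∀ r : ℝ, HasDerivAt (fun u => γ (r * u)) (γ' (r * u) * r) u := fun r => by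
    have := (h (r * u)).comp u ((hasDerivAt_id u).const_mul r)
    simpa [Function.comp_def] using this
  refine ((((h1 s).const_mul A).sub ((h1 s').const_mul B)).add_const c).congr_deriv ?_
  ring

/-- The Laplacian of `γ(b² |x|²) - γ(a² |x|²) + c` in the plane. -/
theorem laplacian_logProfile (hγ : ContDiff ℝ ∞ γ) (x : Plane) :
    ∑ i, fderiv ℝ (fun y : Plane => fderiv ℝ (fun x : Plane =>
      γ (b ^ 2 * ‖x‖ ^ 2) - γ (a ^ 2 * ‖x‖ ^ 2) + c) y (EuclideanSpace.single i 1)) x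
      (EuclideanSpace.single i 1) =
    b ^ 2 * (4 * deriv γ (b ^ 2 * ‖x‖ ^ 2) +
      4 * (b ^ 2 * ‖x‖ ^ 2) * deriv (deriv γ) (b ^ 2 * ‖x‖ ^ 2)) -
    a ^ 2 * (4 * deriv γ (a ^ 2 * ‖x‖ ^ 2) +
      4 * (a ^ 2 * ‖x‖ ^ 2) * deriv (deriv γ) (a ^ 2 * ‖x‖ ^ 2)) := by
  have hd : ∀ u, HasDerivAt γ (deriv γ u) u := fun u =>
    (hγ.differentiable (by simp) u).hasDerivAt
  have hd' : ∀ u, HasDerivAt (deriv γ) (deriv (deriv γ) u) u := fun u =>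
    (((contDiff_infty_iff_deriv.1 hγ).2).differentiable (by simp) u).hasDerivAt
  set g : ℝ → ℝ := fun u => γ (b ^ 2 * u) - γ (a ^ 2 * u) + c with hg
  have hgc : ContDiff ℝ ∞ g := by
    have h1 : ∀ r : ℝ, ContDiff ℝ ∞ fun u => γ (r * u) := fun r =>
      hγ.comp (contDiff_const.mul contDiff_id)
    exact ((h1 _).sub (h1 _)).add contDiff_const
  have e1 : deriv g = fun u => b ^ 2 * deriv γ (b ^ 2 * u) - a ^ 2 * deriv γ (a ^ 2 * u) + 0 := by
    funext u
    have := (hasDerivAt_logProfile (s := b ^ 2) (s' := a ^ 2) (A := 1) (B := 1) (c := c) hd u)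
    simp only [one_mul] at this
    rw [hg, this.deriv, add_zero]
  have e2 : ∀ u, deriv (deriv g) u = b ^ 2 * b ^ 2 * deriv (deriv γ) (b ^ 2 * u) -
      a ^ 2 * a ^ 2 * deriv (deriv γ) (a ^ 2 * u) := fun u => by
    rw [e1, (hasDerivAt_logProfile hd' u).deriv]
  have h := laplacian_radial (d := 2) hgc x
  rw [h, e2, e1]
  push_cast
  ring

end LogProfile

/-- Radial test functions of arbitrarily large energy whose pairing with the `H¹` functions
vanishing on `aboveCone t` is uniformly bounded. -/
theorem exists_log_testFunction {t : ℝ} (ht : 0 ≤ t) : ∃ C : ℝ, ∀ K : ℝ, 1 ≤ K →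
    ∃ G : Plane → ℝ, IsTestFunction ⊤ G ∧
      (∃ p : ℝ → ℝ≥0∞, Measurable p ∧
        (∀ x, ENNReal.ofReal (G x ^ 2 + ∑ i, fderiv ℝ G x (EuclideanSpace.single i 1) ^ 2) =
          p ‖x‖) ∧
        ENNReal.ofReal (2 * Real.pi * (K - 1)) ≤ ∫⁻ x : Plane, p ‖x‖) ∧
      ∀ w : H1 (⊤ : TopologicalSpace.Opens Plane),
        (∀ᵐ x : Plane, x ∈ (aboveCone t : Set Plane) → H1.fn w x = 0) →
        ‖(∫ x, G x • H1.fn w x) -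
          ∫ x, (∑ i, fderiv ℝ (fun y => fderiv ℝ G y (EuclideanSpace.single i 1)) x
            (EuclideanSpace.single i 1)) • H1.fn w x‖ ≤ C * ‖w‖ := by
  obtain ⟨γ, hγ, hγ0, hγ1, hγb⟩ := exists_smooth_half_log
  have hγ' : ContDiff ℝ ∞ (deriv γ) := (contDiff_infty_iff_deriv.1 hγ).2
  have hγ'' : ContDiff ℝ ∞ (deriv (deriv γ)) := (contDiff_infty_iff_deriv.1 hγ').2
  -- `H (|x|²)` is the Laplacian of `γ (|x|²)`; it vanishes for `|x| > 1` because `log |x|` is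
  -- harmonic in the plane.
  set H : ℝ → ℝ := fun v => 4 * deriv γ v + 4 * v * deriv (deriv γ) v with hH
  have hHc : ContDiff ℝ ∞ H :=
    (contDiff_const.mul hγ').add ((contDiff_const.mul contDiff_id).mul hγ'')
  have hH0 : ∀ v, 1 < v → H v = 0 := by
    intro v hv
    have : v ≠ 0 := by linarith
    simp only [hH, deriv_eq_of_half_log hγ1 hv, deriv_deriv_eq_of_half_log hγ1 hv]
    field_simp
    ring
  obtain ⟨M, hM⟩ := isCompact_Icc.exists_bound_of_continuousOn (s := Set.Icc (0 : ℝ) 1)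
    hHc.continuous.continuousOn
  have hM0 : 0 ≤ M := (norm_nonneg _).trans (hM 0 (by simp))
  have hHM : ∀ v, 0 ≤ v → |H v| ≤ M := by
    intro v hv
    rcases le_or_gt v 1 with h | h
    · exact hM v ⟨hv, h⟩
    · rw [hH0 v h, abs_zero]
      exact hM0
  refine ⟨2 + 2 * (2 * (t + 2) * M), fun K hK => ?_⟩
  -- The function will be bounded by `1 + K` and supported in the disc of radius `1/b`; this choice
  -- keeps its `L²` norm at most `2`.
  set b : ℝ := 1 + K with hb
  have hb0 : 0 < b := by linarith
  set a : ℝ := b * Real.exp K with ha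
  have ha0 : 0 < a := by positivity
  have hab : b ≤ a := le_mul_of_one_le_right hb0.le (Real.one_le_exp (by linarith))
  -- At `u = |x|²` this is `K` near the vertex, `-log (b |x|)` for `1/a < |x| < 1/(√2 b)`, and `0`
  -- for `|x| > 1/b`, since `a = b e^K`.
  set g : ℝ → ℝ := fun u => γ (b ^ 2 * u) - γ (a ^ 2 * u) + K with hg
  have hgc : ContDiff ℝ ∞ g := by
    have h1 : ∀ r : ℝ, ContDiff ℝ ∞ fun u => γ (r * u) := fun r =>
      hγ.comp (contDiff_const.mul contDiff_id)
    exact ((h1 _).sub (h1 _)).add contDiff_const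
  have hloga : ∀ u, 0 < u → Real.log (a ^ 2 * u) = Real.log (b ^ 2 * u) + 2 * K := by
    intro u hu
    rw [Real.log_mul (by positivity) hu.ne', Real.log_mul (by positivity) hu.ne', Real.log_pow,
      Real.log_pow, ha, Real.log_mul hb0.ne' (Real.exp_pos _).ne', Real.log_exp]
    push_cast
    ring
  have hg0 : ∀ u, 1 < b ^ 2 * u → g u = 0 := by
    intro u hu
    have hu0 : 0 < u := pos_of_mul_pos_right (lt_trans one_pos hu) (by positivity)
    have hau : b ^ 2 * u ≤ a ^ 2 * u := by gcongr
    simp only [hg]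
    rw [hγ1 _ hu.le, hγ1 _ (hu.le.trans hau), hloga u hu0]
    ring
  have hgb : ∀ u, |g u| ≤ 1 + K := by
    intro u
    rcases lt_or_ge 1 (b ^ 2 * u) with h | h
    · rw [hg0 u h, abs_zero]
      linarith
    · have h1 := abs_le.1 (hγb _ h)
      simp only [hg]
      rcases lt_or_ge 1 (a ^ 2 * u) with h' | h'
      · have hu0 : 0 < u := pos_of_mul_pos_right (lt_trans one_pos h') (by positivity)
        have h2 := Real.log_nonneg h'.le
        have h3 := hloga u hu0
        have h4 := Real.log_nonpos (by positivity) h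
        rw [hγ1 _ h'.le, abs_le]
        constructor <;> linarith
      · have h2 := abs_le.1 (hγb _ h')
        rw [abs_le]
        constructor <;> linarith
  have hgd : Differentiable ℝ g := hgc.differentiable (by simp)
  have hGt : IsTestFunction (⊤ : TopologicalSpace.Opens Plane) fun x => g (‖x‖ ^ 2) :=
    isTestFunction_radial hgc (c := 1 / b ^ 2) fun u hu => hg0 u (by
      rw [div_lt_iff₀ (by positivity)] at hu
      linarith)
  have far : ∀ {l : ℝ}, 0 < l → ∀ x : Plane, 1 / l < ‖x‖ → 1 < l ^ 2 * ‖x‖ ^ 2 := by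
    intro l hl x hx
    rw [div_lt_iff₀ hl] at hx
    rw [← mul_pow]
    exact one_lt_pow₀ (by linarith) two_ne_zero
  have hht : ∀ l : ℝ, 0 < l → IsTestFunction (⊤ : TopologicalSpace.Opens Plane)
      fun x => l ^ 2 * H (l ^ 2 * ‖x‖ ^ 2) := fun l hl =>
    isTestFunction_radial (g := fun u => l ^ 2 * H (l ^ 2 * u)) (c := 1 / l ^ 2)
      (contDiff_const.mul (hHc.comp (contDiff_const.mul contDiff_id))) fun u hu => by
        rw [div_lt_iff₀ (by positivity)] at hu
        simp only [hH0 (l ^ 2 * u) (by linarith), mul_zero]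
  refine ⟨fun x => g (‖x‖ ^ 2), hGt, ⟨fun r => ENNReal.ofReal (g (r ^ 2) ^ 2 +
    4 * deriv g (r ^ 2) ^ 2 * r ^ 2), ?_, fun x => ?_, ?_⟩, fun w hw => ?_⟩
  · have h1 := hgc.continuous
    have h2 : Continuous (deriv g) := (contDiff_infty_iff_deriv.1 hgc).2.continuous
    exact (by fun_prop : Continuous fun r => g (r ^ 2) ^ 2 +
      4 * deriv g (r ^ 2) ^ 2 * r ^ 2).measurable.ennreal_ofReal
  · simp only [fderiv_radial hgd, mul_pow, ← Finset.mul_sum]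
    rw [← EuclideanSpace.real_norm_sq_eq x]
    norm_num
  -- For `1/a < r < 1/(2b)` only the inner logarithm is active and the gradient has length `1/r`.
  -- The energy there is at least `2π log (e^K / 2) ≥ 2π (K - 1)`.
  · have hexp : 2 ≤ Real.exp K := by
      have := Real.add_one_le_exp K
      linarith
    have h := ofReal_log_le_lintegral_norm (p := fun r => ENNReal.ofReal (g (r ^ 2) ^ 2 +
      4 * deriv g (r ^ 2) ^ 2 * r ^ 2)) (r₀ := 1 / a) (r₁ := 1 / (2 * b)) ?_ (by positivity) ?_ ?_
    · refine le_trans (ENNReal.ofReal_le_ofReal ?_) h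
      have e : 1 / (2 * b) / (1 / a) = Real.exp K / 2 := by
        rw [ha]
        field_simp
      rw [e, Real.log_div (Real.exp_pos _).ne' two_ne_zero, Real.log_exp]
      have := Real.log_two_lt_d9
      gcongr
      linarith
    · have h1 := hgc.continuous
      have h2 : Continuous (deriv g) := (contDiff_infty_iff_deriv.1 hgc).2.continuous
      exact (by fun_prop : Continuous fun r => g (r ^ 2) ^ 2 +
        4 * deriv g (r ^ 2) ^ 2 * r ^ 2).measurable.ennreal_ofReal
    · apply one_div_le_one_div_of_le (by positivity)
      rw [ha]
      nlinarith
    · intro r hr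
      have hr0 : 0 < r := lt_trans (by positivity) hr.1
      have h1 : 1 < a ^ 2 * r ^ 2 := by
        have := hr.1
        rw [div_lt_iff₀ ha0] at this
        rw [← mul_pow]
        exact one_lt_pow₀ (by linarith) two_ne_zero
      have h2 : b ^ 2 * r ^ 2 < 1 / 2 := by
        have := hr.2
        rw [lt_div_iff₀ (by positivity)] at this
        have h3 : 0 < r * b := by positivity
        nlinarith
      have hz : deriv γ (b ^ 2 * r ^ 2) = 0 := by
        have he : γ =ᶠ[𝓝 (b ^ 2 * r ^ 2)] fun _ => 0 := by
          filter_upwards [gt_mem_nhds h2] with u hu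
          exact hγ0 u hu.le
        rw [he.deriv_eq, deriv_const]
      have hd := (hasDerivAt_logProfile (s := b ^ 2) (s' := a ^ 2) (A := 1) (B := 1) (c := K)
        (fun u => (hγ.differentiable (by simp) u).hasDerivAt) (r ^ 2)).deriv
      simp only [one_mul] at hd
      have hdg : deriv g (r ^ 2) = - (1 / (2 * r ^ 2)) := by
        rw [hg, hd, hz, deriv_eq_of_half_log hγ1 h1]
        field_simp
        ring
      apply ENNReal.ofReal_le_ofReal
      rw [hdg]
      have : 4 * (-(1 / (2 * r ^ 2))) ^ 2 * r ^ 2 = 1 / r ^ 2 := by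
        field_simp
        ring
      rw [this]
      linarith [sq_nonneg (g (r ^ 2))]
  -- The Laplacian splits into rescaled copies of one bump, at scales `1/b` and `1/a`. Each pairing
  -- is bounded independently of its scale, hence of `K`.
  · have hlap : ∫ x : Plane, (∑ i, fderiv ℝ (fun y : Plane => fderiv ℝ (fun x : Plane =>
        g (‖x‖ ^ 2)) y (EuclideanSpace.single i 1)) x (EuclideanSpace.single i 1)) • H1.fn w x =
        (∫ x : Plane, (b ^ 2 * H (b ^ 2 * ‖x‖ ^ 2)) • H1.fn w x) -
          ∫ x : Plane, (a ^ 2 * H (a ^ 2 * ‖x‖ ^ 2)) • H1.fn w x := by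
      have hint : ∀ l : ℝ, 0 < l →
          Integrable fun x : Plane => (l ^ 2 * H (l ^ 2 * ‖x‖ ^ 2)) • H1.fn w x := fun l hl => by
        have := integrable_smul (hht l hl).contDiff.continuous (hht l hl).hasCompactSupport
          (Lp.memLp (H1.fn w))
        simpa only [TopologicalSpace.Opens.coe_top, Measure.restrict_univ] using this
      rw [← integral_sub (hint b hb0) (hint a ha0)]
      congr 1
      funext x
      rw [← sub_smul]
      congr 1
      exact laplacian_logProfile hγ x
    rw [hlap]
    have hpair : ∀ l : ℝ, 0 < l →
        ‖∫ x : Plane, (l ^ 2 * H (l ^ 2 * ‖x‖ ^ 2)) • H1.fn w x‖ ≤ 2 * (t + 2) * M * ‖w‖ :=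
      fun l hl => norm_integral_smul_le_of_vanishing ht hw (hht l hl) hl hM0
        (fun x => by
          rw [abs_mul, abs_of_nonneg (by positivity : 0 ≤ l ^ 2)]
          gcongr
          exact hHM _ (by positivity))
        (fun x hx => by rw [hH0 _ (far hl x hx), mul_zero])
    have hG : ‖∫ x : Plane, g (‖x‖ ^ 2) • H1.fn w x‖ ≤ 2 * ‖w‖ := by
      have hfn := H1.eLpNorm_fn_le w
      have hfm := (Lp.memLp (H1.fn w)).1
      simp only [TopologicalSpace.Opens.coe_top, Measure.restrict_univ] at hfn hfm
      rw [← ofReal_norm] at hfn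
      have h1 := norm_integral_smul_le_of_eLpNorm_le
        (hGt.contDiff.continuous.memLp_of_hasCompactSupport hGt.hasCompactSupport) hfm
        (norm_nonneg _) hfn
      have h2 := toReal_eLpNorm_le_of_bounded (k := fun x : Plane => g (‖x‖ ^ 2)) (M := 1 + K)
        (r := 1 / b) (by linarith) (by positivity) (fun x => hgb _)
        (fun x hx => hg0 _ (far hb0 x hx))
      have h3 : 2 * (1 + K) * (1 / b) = 2 := by
        rw [← hb]
        field_simp
      rw [h3] at h2
      exact h1.trans (mul_le_mul_of_nonneg_right h2 (norm_nonneg _))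
    calc _ ≤ ‖∫ x : Plane, g (‖x‖ ^ 2) • H1.fn w x‖ +
          (‖∫ x : Plane, (b ^ 2 * H (b ^ 2 * ‖x‖ ^ 2)) • H1.fn w x‖ +
          ‖∫ x : Plane, (a ^ 2 * H (a ^ 2 * ‖x‖ ^ 2)) • H1.fn w x‖) :=
          (norm_sub_le _ _).trans (add_le_add le_rfl (norm_sub_le _ _))
      _ ≤ 2 * ‖w‖ + (2 * (t + 2) * M * ‖w‖ + 2 * (t + 2) * M * ‖w‖) :=
          add_le_add hG (add_le_add (hpair b hb0) (hpair a ha0))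
      _ = _ := by ring

/-! ### The lower bound -/

/-- The difference `w = E f - F` vanishes on the wedge, so `‖F + w‖² ≥ ‖F‖² - 2C ‖w‖ + ‖w‖²`;
completing the square costs only `C²`. -/
theorem norm_sq_extension_ge {t : ℝ}
    {E : H1 (aboveCone t) →L[ℂ] H1 (⊤ : TopologicalSpace.Opens Plane)}
    (hE : IsExtensionOperator E) {G : Plane → ℝ} (hG : IsTestFunction ⊤ G) {C : ℝ}
    (hC : ∀ w : H1 (⊤ : TopologicalSpace.Opens Plane),
        (∀ᵐ x : Plane, x ∈ (aboveCone t : Set Plane) → H1.fn w x = 0) →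
        ‖(∫ x, G x • H1.fn w x) -
          ∫ x, (∑ i, fderiv ℝ (fun y => fderiv ℝ G y (EuclideanSpace.single i 1)) x
            (EuclideanSpace.single i 1)) • H1.fn w x‖ ≤ C * ‖w‖)
    {f : H1 (aboveCone t)} {F : H1 (⊤ : TopologicalSpace.Opens Plane)}
    (hf : H1.fn f =ᵐ[volume.restrict (aboveCone t : Set Plane)] (fun x => (G x : ℂ)))
    (hF1 : H1.fn F =ᵐ[volume.restrict ((⊤ : TopologicalSpace.Opens Plane) : Set Plane)]
      (fun x => (G x : ℂ)))
    (hF2 : ∀ i, (fun x => H1.grad F x i) =ᵐ[volume.restrict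
      ((⊤ : TopologicalSpace.Opens Plane) : Set Plane)]
        fun x => ((fderiv ℝ G x (EuclideanSpace.single i 1) : ℝ) : ℂ)) :
    ‖F‖ ^ 2 - C ^ 2 ≤ ‖E f‖ ^ 2 := by
  set w := E f - F with hw
  have hvan : ∀ᵐ x : Plane, x ∈ (aboveCone t : Set Plane) → H1.fn w x = 0 := by
    have h1 := (ae_restrict_iff' (aboveCone t).isOpen.measurableSet).1 (hE f)
    have h2 := (ae_restrict_iff' (aboveCone t).isOpen.measurableSet).1 hf
    have h3 := ae_restrict_top.1 hF1
    have h4 := ae_restrict_top.1 (Lp.coeFn_sub (H1.fn (E f)) (H1.fn F))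
    filter_upwards [h1, h2, h3, h4] with x a1 a2 a3 a4 hx
    change (H1.fn (E f) - H1.fn F : L2 ⊤) x = 0
    rw [a4, Pi.sub_apply, a1 hx, a2 hx, a3, sub_self]
  have h1 := hC w hvan
  rw [← H1.inner_testFunction_eq hG hF1 hF2] at h1
  have h2 : E f = F + w := by rw [hw, add_sub_cancel]
  have h3 := norm_add_sq (𝕜 := ℂ) F w
  have h4 : -(C * ‖w‖) ≤ RCLike.re (inner ℂ F w) :=
    (abs_le.1 ((RCLike.abs_re_le_norm _).trans h1)).1
  rw [h2, h3]
  have h5 : (‖w‖ - C) ^ 2 = ‖w‖ ^ 2 - 2 * (C * ‖w‖) + C ^ 2 := by ring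
  linarith [sq_nonneg (‖w‖ - C)]

/-- The norm of an extension operator for the wedge of angle `π - θ` is at least
`√(2π / (π - θ))`. -/
theorem two_pi_le_norm_sq_extension {θ : ℝ} (hθ : 0 < θ) (hθπ : θ < Real.pi)
    {E : H1 (aboveCone (Real.tan (θ / 2))) →L[ℂ] H1 (⊤ : TopologicalSpace.Opens Plane)}
    (hE : IsExtensionOperator E) : 2 * Real.pi ≤ (Real.pi - θ) * ‖E‖ ^ 2 := by
  have ht : 0 ≤ Real.tan (θ / 2) :=
    Real.tan_nonneg_of_nonneg_of_le_pi_div_two (by linarith) (by linarith)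
  obtain ⟨C, hC⟩ := exists_log_testFunction ht
  set κ : ℝ := (Real.pi - θ) / (2 * Real.pi) with hκ
  have hπ := Real.pi_pos
  have hκ0 : 0 ≤ κ := div_nonneg (by linarith) (by positivity)
  have key : ∀ K : ℝ, 1 ≤ K → ∃ N : ℝ, 2 * Real.pi * (K - 1) ≤ N ∧
      N - C ^ 2 ≤ ‖E‖ ^ 2 * κ * N := by
    intro K hK
    obtain ⟨G, hG, ⟨p, hp, hpG, hpK⟩, hCG⟩ := hC K hK
    obtain ⟨f, hf1, hf2⟩ := hG.exists_H1 (aboveCone (Real.tan (θ / 2)))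
    obtain ⟨F, hF1, hF2⟩ := hG.exists_H1 ⊤
    have hnf := H1.enorm_sq_of_testFunction hf1 hf2
    have hnF := H1.enorm_sq_of_testFunction hF1 hF2
    simp only [hpG] at hnf hnF
    rw [setLIntegral_top] at hnF
    have h1 : ‖f‖ ^ 2 ≤ κ * ‖F‖ ^ 2 := by
      have := setLIntegral_aboveCone_norm_le hθ hθπ hp
      rw [← hnf, ← hnF, enorm_sq_eq_ofReal, enorm_sq_eq_ofReal, ← ENNReal.ofReal_mul hκ0] at this
      exact (ENNReal.ofReal_le_ofReal_iff (by positivity)).1 this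
    have h2 := norm_sq_extension_ge hE hG hCG hf1 hF1 hF2
    have h3 : ‖E f‖ ^ 2 ≤ ‖E‖ ^ 2 * ‖f‖ ^ 2 := by
      rw [← mul_pow]
      exact pow_le_pow_left₀ (norm_nonneg _) (E.le_opNorm f) 2
    refine ⟨‖F‖ ^ 2, ?_, ?_⟩
    · rw [← hnF, enorm_sq_eq_ofReal] at hpK
      exact (ENNReal.ofReal_le_ofReal_iff (by positivity)).1 hpK
    · rw [mul_assoc]
      exact h2.trans (h3.trans (mul_le_mul_of_nonneg_left h1 (sq_nonneg _)))
  have h1 : 1 ≤ ‖E‖ ^ 2 * κ := by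
    by_contra hlt
    rw [not_le] at hlt
    set δ : ℝ := 1 - ‖E‖ ^ 2 * κ with hδ
    have hδ0 : 0 < δ := by linarith
    -- If `‖E‖² κ = 1 - δ` with `δ > 0`, then `key` forces `N δ ≤ C²`; this `K` makes the energy `N`
    -- larger than `C² / δ`.
    obtain ⟨N, hN1, hN2⟩ := key (2 + C ^ 2 / δ) (by
      have : 0 ≤ C ^ 2 / δ := by positivity
      linarith)
    have h2 : C ^ 2 / δ < N := by
      refine lt_of_lt_of_le ?_ hN1
      have h3 : 0 ≤ C ^ 2 / δ := by positivity
      have h4 := mul_le_mul_of_nonneg_right (by linarith [Real.pi_gt_three] : 1 ≤ 2 * Real.pi)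
        (by linarith : 0 ≤ 2 + C ^ 2 / δ - 1)
      linarith
    rw [div_lt_iff₀ hδ0] at h2
    have h5 : ‖E‖ ^ 2 * κ * N = N - N * δ := by
      rw [hδ]
      ring
    linarith
  rw [hκ, ← mul_div_assoc, le_div_iff₀ (by positivity)] at h1
  linarith

/-! ### Elementary estimates in `θ` -/

theorem sqrt_two_add_le_of_two_pi_le {θ c : ℝ} (hθ : 0 < θ) (hθπ : θ < Real.pi) (hc : 0 ≤ c)
    (h : 2 * Real.pi ≤ (Real.pi - θ) * c ^ 2) : √2 + √2 / 32 * θ ^ 2 ≤ c := by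
  refine (pow_le_pow_iff_left₀ (by positivity) hc two_ne_zero).1 ?_
  have hs : √2 ^ 2 = 2 := Real.sq_sqrt (by norm_num)
  have e : (√2 + √2 / 32 * θ ^ 2) ^ 2 = 2 * (1 + θ ^ 2 / 32) ^ 2 := by
    linear_combination (1 + θ ^ 2 / 32) ^ 2 * hs
  rw [e]
  have hπ := Real.pi_lt_d2
  have h0 : 0 < Real.pi - θ := by linarith
  refine le_of_mul_le_mul_left (le_trans ?_ h) h0
  -- A linear majorant with slope below `1/π` suffices, as `(π - θ)(1 + θ/π) ≤ π`; the slope `5/16`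
  -- works because `π < 16/5`.
  have h1 : (1 + θ ^ 2 / 32) ^ 2 ≤ 1 + 5 / 16 * θ := by
    have h2 : θ ^ 2 / 32 ≤ θ / 8 := by
      have := mul_le_mul_of_nonneg_left (by linarith : θ ≤ 4) hθ.le
      rw [sq]
      linarith
    have h3 : (θ ^ 2 / 32) ^ 2 ≤ θ / 8 * (1 / 2) := by
      rw [sq]
      exact mul_le_mul h2 (by linarith) (by positivity) (by positivity)
    have h4 : (1 + θ ^ 2 / 32) ^ 2 = 1 + 2 * (θ ^ 2 / 32) + (θ ^ 2 / 32) ^ 2 := by ring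
    linarith
  have h2 := mul_le_mul_of_nonneg_left h1 h0.le
  have h3 : (Real.pi - θ) * (1 + 5 / 16 * θ) =
      Real.pi - θ * (1 - 5 / 16 * Real.pi) - 5 / 16 * θ ^ 2 := by ring
  have h4 : 0 ≤ θ * (1 - 5 / 16 * Real.pi) := mul_nonneg hθ.le (by linarith)
  linarith [sq_nonneg θ]

theorem cot_pi_sub_div_two (θ : ℝ) : Real.cot ((Real.pi - θ) / 2) = Real.tan (θ / 2) := by
  rw [Real.cot_eq_cos_div_sin, Real.tan_eq_sin_div_cos, sub_div, Real.cos_pi_div_two_sub,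
    Real.sin_pi_div_two_sub]

/-- At `0` the radicand has value `2` and derivative `1`, the squared tangent contributing nothing,
so the root has derivative `1/(2√2) = √2/4`. -/
theorem isLittleO_sqrt_sub : (fun θ : ℝ =>
    √(2 + 2 * Real.tan (θ / 2) + 4 * Real.tan (θ / 2) ^ 2) - √2 - √2 / 4 * θ)
      =o[𝓝 (0 : ℝ)] fun θ : ℝ => θ := by
  have h1 : HasDerivAt (fun θ : ℝ => Real.tan (θ / 2)) (1 / 2) 0 := by
    have h2 : HasDerivAt Real.tan (1 / Real.cos (0 / 2) ^ 2) ((0 : ℝ) / 2) :=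
      Real.hasDerivAt_tan (by simp)
    have h3 := h2.comp (0 : ℝ) ((hasDerivAt_id (0 : ℝ)).div_const 2)
    simpa [Function.comp_def] using h3
  have h4 := ((h1.const_mul 2).const_add 2).add ((h1.pow 2).const_mul 4)
  have h5 := h4.sqrt (by simp)
  have hs : √2 * √2 = 2 := Real.mul_self_sqrt (by norm_num)
  have h6 : HasDerivAt (fun θ : ℝ => √(2 + 2 * Real.tan (θ / 2) + 4 * Real.tan (θ / 2) ^ 2))
      (√2 / 4) 0 := by
    refine h5.congr_deriv ?_
    have h0 : √2 ≠ 0 := by positivity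
    simp
    field_simp
    linarith
  have h7 := h6.isLittleO
  simpa [mul_comm] using h7

end SobolevExtension

end

theorem mainTheorem5 :
    ∃ r₁ r₂ : ℝ → ℝ,
      r₁ =o[𝓝[>] (0 : ℝ)] (fun θ : ℝ => θ ^ 2) ∧
      r₂ =o[𝓝[>] (0 : ℝ)] (fun θ : ℝ => θ) ∧
      ∀ θ ∈ Set.Ioo (0 : ℝ) Real.pi,
        (∃ E : SobolevExtension.H1 (SobolevExtension.wedge (Real.pi - θ)) →L[ℂ]
            SobolevExtension.H1 (⊤ : TopologicalSpace.Opens (EuclideanSpace ℝ (Fin 2))),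
          SobolevExtension.IsExtensionOperator E) ∧
        √2 + √2 / 32 * θ ^ 2 + r₁ θ ≤
          SobolevExtension.minExtensionNorm (SobolevExtension.wedge (Real.pi - θ)) ∧
        SobolevExtension.minExtensionNorm (SobolevExtension.wedge (Real.pi - θ)) ≤
          √2 + √2 / 4 * θ + r₂ θ := by
  set u : ℝ → ℝ := fun θ =>
    √(2 + 2 * Real.tan (θ / 2) + 4 * Real.tan (θ / 2) ^ 2) - √2 - √2 / 4 * θ with hu
  -- The lower bound holds on all of `(0, π)` without error term, while `u` is exactly the gap
  -- between the reflection's norm bound and its linearization.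
  refine ⟨fun _ => 0, u, isLittleO_zero _ _,
    SobolevExtension.isLittleO_sqrt_sub.mono nhdsWithin_le_nhds, fun θ hθ => ?_⟩
  have ht : 0 ≤ Real.tan (θ / 2) :=
    Real.tan_nonneg_of_nonneg_of_le_pi_div_two (by linarith [hθ.1]) (by linarith [hθ.2])
  rw [SobolevExtension.wedge_eq_aboveCone, SobolevExtension.cot_pi_sub_div_two]
  obtain ⟨E, hE, hEn⟩ := SobolevExtension.exists_extensionOperator ht
  refine ⟨⟨E, hE⟩, ?_, ?_⟩
  · rw [add_zero]
    refine le_csInf ⟨‖E‖, E, hE, rfl⟩ ?_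
    rintro c ⟨E', hE', rfl⟩
    exact SobolevExtension.sqrt_two_add_le_of_two_pi_le hθ.1 hθ.2 E'.opNorm_nonneg
      (SobolevExtension.two_pi_le_norm_sq_extension hθ.1 hθ.2 hE')
  · have h : SobolevExtension.minExtensionNorm
        (SobolevExtension.aboveCone (Real.tan (θ / 2))) ≤ ‖E‖ := by
      refine csInf_le ⟨0, ?_⟩ ⟨E, hE, rfl⟩
      rintro c ⟨E', _, rfl⟩
      exact E'.opNorm_nonneg
    simp only [hu]
    linarith
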